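/- Let $d\ge 1$, let $B_1$ be the open unit ball of $\mathbb R^d$, and let $\Delta_\infty v=\sum_{i,j}v_iv_jv_{ij}=(\nabla v)^tD^2v\,\nabla v$ denote the infinity-Laplacian. Let $u\in C^0(B_1)$ and let $f\colon B_1\to\mathbb R$ be in $L^\infty(B_1)$. Suppose that $\Delta_\infty u=f$ in $B_1$ in the viscosity sense: for every $Y\in B_1$ and every smooth $\eta$, if $u-\eta$ has a local minimum at $Y$ then $\Delta_\infty\eta(Y)\le f(Y)$, and if $u-\eta$ has a local maximum at $Y$ then $\Delta_\infty\eta(Y)\ge f(Y)$. Suppose that $u$ is smooth up to a possible radial singularity at a point $X_0\in B_1$: there are an open neighbourhood $V\subseteq B_1$ of $X_0$, a function $\varphi\in C^2(V)$ with $\varphi(X)=O(|X-X_0|^2)$ as $X\to X_0$, and a function $\psi$ of one real variable such that $$u(X)=\varphi(X)+\psi(|X-X_0|)\qquad\text{for all }X\in V.$$ Then $u\in C^{1,1/3}_{\mathrm{loc}}(V)$, that is, $u$ is continuously differentiable in $V$ and $\nabla u$ is Hölder continuous with exponent $1/3$ on every compact subset of $V$. If, in addition, $u$ is of class $C^2$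 near every point of $B_1\setminus V$ (in particular, if $V=B_1$), then $u\in C^{1,1/3}_{\mathrm{loc}}(B_1)$. The exponent $1/3$ is optimal: for every $d\ge1$ there are such $u$, $f$ and $X_0$, with $V=B_1$, for which $u\notin C^{1,\alpha}_{\mathrm{loc}}(B_1)$ for every $\alpha>1/3$. -/

import Mathlib

open scoped ContDiff NNReal Topology

/-- The infinity-Laplacian `Δ_∞ v (X) = ∑ i j, v_i v_j v_ij = (∇v)ᵗ D²v ∇v`, that is, the second
derivative of `v` at `X` applied twice to the gradient. It is only used for smooth `v`. -/
noncomputable def infinityLaplacian {d : ℕ} (v : EuclideanSpace ℝ (Fin d) → ℝ)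
    (X : EuclideanSpace ℝ (Fin d)) : ℝ :=
  fderiv ℝ (fderiv ℝ v) X (gradient v X) (gradient v X)

/-- `Δ_∞ u ≤ f` in `U` in the viscosity sense: the inequality is tested at every point of `U` at
which a smooth function touches the graph of `u` from below. -/
def IsViscositySupersolution {d : ℕ} (u f : EuclideanSpace ℝ (Fin d) → ℝ)
    (U : Set (EuclideanSpace ℝ (Fin d))) : Prop :=
  ∀ Y ∈ U, ∀ η : EuclideanSpace ℝ (Fin d) → ℝ, ContDiff ℝ ∞ η →
    IsLocalMin (fun X => u X - η X) Y → infinityLaplacian η Y ≤ f Y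

/-- `Δ_∞ u ≥ f` in `U` in the viscosity sense: the inequality is tested at every point of `U` at
which a smooth function touches the graph of `u` from above. -/
def IsViscositySubsolution {d : ℕ} (u f : EuclideanSpace ℝ (Fin d) → ℝ)
    (U : Set (EuclideanSpace ℝ (Fin d))) : Prop :=
  ∀ Y ∈ U, ∀ η : EuclideanSpace ℝ (Fin d) → ℝ, ContDiff ℝ ∞ η →
    IsLocalMax (fun X => u X - η X) Y → f Y ≤ infinityLaplacian η Y

/-- `u ∈ C⁰(U)` and `Δ_∞ u = f` in `U` in the viscosity sense. -/
def IsViscositySolution {d : ℕ} (u f : EuclideanSpace ℝ (Fin d) → ℝ)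
    (U : Set (EuclideanSpace ℝ (Fin d))) : Prop :=
  ContinuousOn u U ∧ IsViscositySupersolution u f U ∧ IsViscositySubsolution u f U

/-- In `V` (in the applications, an open neighbourhood of `X₀`) the function `u` is smooth up to a
possible radial singularity at `X₀`: `u(X) = φ(X) + ψ(|X - X₀|)` in `V`, with `φ` of class `C²` in
`V` and `φ(X) = O(|X - X₀|²)`. -/
def SmoothUpToRadialSingularityOn {d : ℕ} (u : EuclideanSpace ℝ (Fin d) → ℝ)
    (X₀ : EuclideanSpace ℝ (Fin d)) (V : Set (EuclideanSpace ℝ (Fin d))) : Prop :=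
  ∃ (φ : EuclideanSpace ℝ (Fin d) → ℝ) (ψ : ℝ → ℝ),
    ContDiffOn ℝ 2 φ V ∧
    φ =O[𝓝 X₀] (fun X => ‖X - X₀‖ ^ 2) ∧
    ∀ X ∈ V, u X = φ X + ψ ‖X - X₀‖

/-- `u ∈ C^{1,α}_loc(U)` for an open set `U`: `u` is continuously differentiable in `U` and its
gradient is Hölder continuous with exponent `α` on every compact subset of `U`. -/
def IsC1HolderLoc {d : ℕ} (α : ℝ≥0) (u : EuclideanSpace ℝ (Fin d) → ℝ)
    (U : Set (EuclideanSpace ℝ (Fin d))) : Prop :=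
  ContDiffOn ℝ 1 u U ∧
    ∀ K : Set (EuclideanSpace ℝ (Fin d)), K ⊆ U → IsCompact K →
      ∃ C : ℝ≥0, HolderOnWith C α (gradient u) K

open MeasureTheory Set Filter

/-! Along a ray X₀ + rθ the equation becomes one-dimensional. If a quadratic touches w(r) = u(X₀ +
rθ) from below at some r > 0, adding to φ the radial function that makes up the difference on the
ray gives a C² function T with u − T radial, so T touches u from below near that point
(`IsViscositySupersolution.ray_test`). Controlling the terms in φ yields w'² w'' ≤ f + C(1 + |w'|),
and the same for −u gives the reverse bound. Since 3 w'² w'' = (w'³)', the cube of w' should be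
Lipschitz; taking the cube root costs the exponent 1/3.

Two points need care. First, f is only essentially bounded, while the viscosity inequality uses its
value at each point. Polar coordinates show that along almost every direction f is bounded at almost
every radius, and one such direction suffices because ψ does not depend on θ. The remaining null set
of radii is handled in the comparison argument `IsRaySupersolution.quadratic_le` by a small convex
function with infinite curvature on that set. Second, no derivative of w is known in advance. A
Lipschitz bound on w first absorbs the term in |w'|; then the cubes of difference quotients are
compared (`IsRaySupersolution.slope_cube_ge`), and differentiability follows with the Hölder bound
(`exists_deriv_of_slope_cube_close`).

At X₀ the one-sided derivative ψ'(0) vanishes, because a cone can be touched by paraboloids of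
nonzero slope and arbitrarily large curvature. Hence ∇u = ∇φ + ψ'(|X − X₀|)(X − X₀)/|X − X₀| is
Hölder continuous (`norm_radial_sub_le`). The exponent is attained by |X|^(4/3), whose
infinity-Laplacian is 64/81 away from the origin. -/

/-! ### Convex functions with infinite curvature on a null set. -/

/-- A null set of reals carries a small bounded monotone function with infinite slope on it. -/
lemma exists_monotone_steep {N : Set ℝ} (hN : volume N = 0) {ε : ℝ} (hε : 0 < ε) :
    ∃ g : ℝ → ℝ, Monotone g ∧ (∀ x, 0 ≤ g x ∧ g x ≤ ε) ∧
      ∀ y ∈ N, ∀ K : ℕ, ∀ᶠ x in 𝓝 y, K * (x - y) ^ 2 ≤ (g x - g y) * (x - y) := by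
  obtain ⟨δ, hδ, hsum⟩ := ENNReal.exists_pos_sum_of_countable' (ε := ENNReal.ofReal ε)
    (by simpa using hε) ℕ
  have hU (n : ℕ) : ∃ U ⊇ N, IsOpen U ∧ volume U < δ n :=
    Set.exists_isOpen_lt_of_lt N _ (by rw [hN]; exact hδ n)
  choose U hNU hUo hUδ using hU
  -- The `U n` have summable small measure, so μ has mass at most ε; near a point of `N` the first
  -- `K` of them all contain a common neighbourhood, so there μ has density at least `K`. The
  -- function g is the distribution function of μ.
  set μ : Measure ℝ := Measure.sum fun n => volume.restrict (U n) with hμ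
  have hμuniv : μ univ ≤ ENNReal.ofReal ε := by
    rw [hμ, Measure.sum_apply _ MeasurableSet.univ]
    refine le_trans (ENNReal.tsum_le_tsum fun n => ?_) hsum.le
    simpa using (hUδ n).le
  have : IsFiniteMeasure μ := ⟨hμuniv.trans_lt ENNReal.ofReal_lt_top⟩
  have hdiff {y x : ℝ} (h : y ≤ x) : μ.real (Iic x) - μ.real (Iic y) = μ.real (Ioc y x) := by
    rw [← Iic_sdiff_Iic, measureReal_sdiff (Iic_subset_Iic.2 h) measurableSet_Iic]
  have key {K : ℕ} {y x : ℝ} (h : y ≤ x) (hU : ∀ n < K, Ioc y x ⊆ U n) :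
      K * (x - y) ≤ μ.real (Ioc y x) := by
    have : ENNReal.ofReal (K * (x - y)) ≤ μ (Ioc y x) := by
      rw [hμ, Measure.sum_apply _ measurableSet_Ioc]
      refine le_trans ?_ (ENNReal.sum_le_tsum (Finset.range K))
      rw [Finset.sum_congr rfl (g := fun _ => ENNReal.ofReal (x - y))]
      · rw [ENNReal.ofReal_mul (by positivity)]; simp
      · intro n hn
        rw [Measure.restrict_apply measurableSet_Ioc,
          inter_eq_left.2 (hU n (Finset.mem_range.1 hn)), Real.volume_Ioc]
    rw [Measure.real]
    exact (ENNReal.ofReal_le_iff_le_toReal (measure_ne_top _ _)).1 this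
  refine ⟨fun x => μ.real (Iic x), fun x y h => measureReal_mono (Iic_subset_Iic.2 h),
    fun x => ⟨measureReal_nonneg, ?_⟩, fun y hy K => ?_⟩
  · refine ENNReal.toReal_le_of_le_ofReal hε.le (le_trans (measure_mono (subset_univ _)) hμuniv)
  · have : ∀ᶠ x in 𝓝 y, ∀ n < K, uIcc y x ⊆ U n := by
      have h1 : (⋂ n ∈ Finset.range K, U n) ∈ 𝓝 y :=
        (biInter_finset_mem _).2 fun n _ => (hUo n).mem_nhds (hNU n hy)
      obtain ⟨r, hr, hb⟩ := Metric.mem_nhds_iff.1 h1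
      filter_upwards [Metric.ball_mem_nhds y hr] with x hx n hn
      have h2 : uIcc y x ⊆ Metric.ball y r :=
        (convex_ball y r).ordConnected.uIcc_subset (Metric.mem_ball_self hr) hx
      exact fun z hz => mem_iInter₂.1 (hb (h2 hz)) n (Finset.mem_range.2 hn)
    filter_upwards [this] with x hx
    rcases le_total y x with h | h
    · have := key h fun n hn => (Ioc_subset_Icc_self.trans Icc_subset_uIcc).trans (hx n hn)
      rw [hdiff h]
      nlinarith
    · have := key h fun n hn => (Ioc_subset_Icc_self.trans Icc_subset_uIcc').trans (hx n hn)
      rw [← hdiff h] at this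
      nlinarith

/-- A null set of reals carries a small convex function which is steeply curved on it. -/
lemma exists_convex_curved {N : Set ℝ} (hN : volume N = 0) {ε : ℝ} (hε : 0 < ε) :
    ∃ G g : ℝ → ℝ, Continuous G ∧ (∀ x, 0 ≤ g x ∧ g x ≤ ε) ∧
      (∀ x y, g y * (x - y) ≤ G x - G y) ∧
      ∀ y ∈ N, ∀ K : ℕ, ∀ᶠ x in 𝓝 y, g y * (x - y) + K / 2 * (x - y) ^ 2 ≤ G x - G y := by
  obtain ⟨g, hg, hgb, hgN⟩ := exists_monotone_steep hN hε
  have hint (a b : ℝ) : IntervalIntegrable g volume a b := hg.intervalIntegrable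
  have hsub (x y : ℝ) : (∫ t in (0 : ℝ)..x, g t) - ∫ t in (0 : ℝ)..y, g t = ∫ t in y..x, g t :=
    intervalIntegral.integral_interval_sub_left (hint _ _) (hint _ _)
  -- Multiplying by t − y expresses both "g ≥ c + k(t − y) to the right of y" and "≤ to the left" at
  -- once. The case k = 0 gives the subgradient inequality, k = K the extra curvature.
  have lower (c k x y : ℝ) (hle : ∀ t ∈ uIcc y x,
      k * (t - y) ^ 2 ≤ (g t - c) * (t - y)) :
      c * (x - y) + k / 2 * (x - y) ^ 2 ≤ ∫ t in y..x, g t := by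
    have hI : ∫ t in y..x, (c + k * (t - y)) = c * (x - y) + k / 2 * (x - y) ^ 2 := by
      rw [intervalIntegral.integral_add (by simp) (Continuous.intervalIntegrable (by fun_prop) _ _),
        intervalIntegral.integral_const_mul, intervalIntegral.integral_comp_sub_right (fun t => t)]
      simp
      ring
    have hc : IntervalIntegrable (fun t => c + k * (t - y)) volume y x :=
      Continuous.intervalIntegrable (by fun_prop) _ _
    rw [← hI]
    rcases le_total y x with h | h
    · refine intervalIntegral.integral_mono_on_of_le_Ioo h hc (hint _ _) fun t ht => ?_
      have h1 := hle t (by rw [uIcc_of_le h]; exact ⟨ht.1.le, ht.2.le⟩)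
      have h2 : 0 < t - y := sub_pos.2 ht.1
      nlinarith [le_of_mul_le_mul_right (a := t - y) (b := k * (t - y)) (c := g t - c)
        (by nlinarith) h2]
    · rw [intervalIntegral.integral_symm x y, intervalIntegral.integral_symm x y]
      refine neg_le_neg (intervalIntegral.integral_mono_on_of_le_Ioo h (hint _ _) hc.symm
        fun t ht => ?_)
      have h1 := hle t (by rw [uIcc_of_ge h]; exact ⟨ht.1.le, ht.2.le⟩)
      have h2 : 0 < y - t := sub_pos.2 ht.2
      nlinarith [le_of_mul_le_mul_right (a := y - t) (b := g t - c) (c := k * (t - y))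
        (by nlinarith) h2]
  refine ⟨fun x => ∫ t in (0 : ℝ)..x, g t, g, intervalIntegral.continuous_primitive hint 0, hgb,
    fun x y => ?_, fun y hy K => ?_⟩
  · rw [hsub]
    have := lower (g y) 0 x y fun t _ => by
      rw [zero_mul]
      rcases le_total y t with h | h
      · exact mul_nonneg (sub_nonneg.2 (hg h)) (sub_nonneg.2 h)
      · exact mul_nonneg_of_nonpos_of_nonpos (sub_nonpos.2 (hg h)) (sub_nonpos.2 h)
    simpa using this
  · obtain ⟨r, hr, hb⟩ := Metric.eventually_nhds_iff_ball.1 (hgN y hy K)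
    filter_upwards [Metric.ball_mem_nhds y hr] with x hx
    rw [hsub]
    exact lower (g y) K x y fun t ht => hb t
      ((convex_ball y r).ordConnected.uIcc_subset (Metric.mem_ball_self hr) hx ht)

/-! ### One-dimensional viscosity inequalities: cubes of slopes are Lipschitz. -/

/-- The quadratic with value `w r`, slope `p` and second derivative `m` at `r` touches `w` at `r`
from below. -/
def TouchesBelow (w : ℝ → ℝ) (r p m : ℝ) : Prop :=
  ∀ᶠ x in 𝓝 r, w r + p * (x - r) + m / 2 * (x - r) ^ 2 ≤ w x

/-- `w'² w'' ≤ F + C (1 + |w'|)` in `S`, in the viscosity sense. -/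
def IsRaySupersolution (w F : ℝ → ℝ) (C : ℝ) (S : Set ℝ) : Prop :=
  ∀ r ∈ S, ∀ p m, TouchesBelow w r p m → p ^ 2 * m ≤ F r + C * (1 + |p|)

/-- A comparison principle. If the quadratic h exceeded w somewhere, w − h − G would have an
interior minimum, with G from `exists_convex_curved`; there w is touched from below with a slope and
curvature that violate the supersolution inequality. Strictness is asked on the whole range of
slopes of h, enlarged by ε to make room for the slope of G; q ≠ 0 is what excludes the points where
F > M. -/
lemma IsRaySupersolution.quadratic_le {w F : ℝ → ℝ} {C M s t a m ε : ℝ}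
    (hw : IsRaySupersolution w F C (Ioo s t)) (hF : ∀ᵐ r, r ∈ Ioo s t → F r ≤ M)
    (hc : ContinuousOn w (Icc s t)) (hst : s < t) (hm : 0 ≤ m) (hε : 0 < ε)
    (hstrict : ∀ q ∈ Icc a (a + m * (t - s) + ε), q ≠ 0 ∧ M + C * (1 + |q|) < q ^ 2 * m)
    (ht : w s + a * (t - s) + m / 2 * (t - s) ^ 2 ≤ w t) {r : ℝ} (hr : r ∈ Icc s t) :
    w s + a * (r - s) + m / 2 * (r - s) ^ 2 ≤ w r := by
  by_contra! hneg
  set h : ℝ → ℝ := fun x => w s + a * (x - s) + m / 2 * (x - s) ^ 2 with hh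
  set η : ℝ := h r - w r with hη
  have hη0 : 0 < η := sub_pos.2 hneg
  have hN : volume {x | x ∈ Ioo s t ∧ ¬ F x ≤ M} = 0 := by
    simpa [ae_iff, and_assoc] using hF
  -- The first entry keeps the perturbed slope inside the range of `hstrict`; the second keeps the
  -- growth of G below η/2, so that the minimum cannot sit at t.
  set ε' : ℝ := min ε (η / (2 * (t - s)))
  have hts : 0 < t - s := sub_pos.2 hst
  have hε' : 0 < ε' := lt_min hε (by positivity)
  obtain ⟨G, g, hGc, hgb, hGg, hGN⟩ := exists_convex_curved hN hε'
  obtain ⟨y, hy, hmin⟩ := isCompact_Icc.exists_isMinOn (nonempty_Icc.2 hst.le)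
    (f := fun x => w x - h x - G x) ((hc.sub (by fun_prop)).sub hGc.continuousOn)
  have hle : ∀ x ∈ Icc s t, w y - h y - G y ≤ w x - h x - G x := fun x hx => hmin hx
  have hsmall : ε' * (t - s) ≤ η / 2 := by
    calc ε' * (t - s) ≤ η / (2 * (t - s)) * (t - s) := by gcongr; exact min_le_right _ _
      _ = η / 2 := by field_simp
  have hGup : ∀ x, s ≤ x → x ≤ t → ∀ z, s ≤ z → z ≤ t → x ≤ z → G z - G x ≤ η / 2 := by
    intro x hx1 hx2 z hz1 hz2 hxz
    have h1 := hGg x z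
    have h2 : g z * (z - x) ≤ ε' * (t - s) :=
      mul_le_mul (hgb z).2 (by linarith) (by linarith) hε'.le
    nlinarith
  have hGmono : ∀ x z, x ≤ z → G x ≤ G z := by
    intro x z hxz
    have h1 := hGg z x
    have h2 := mul_nonneg (hgb x).1 (sub_nonneg.2 hxz)
    linarith
  have hys : y ≠ s := by
    rintro rfl
    have h1 := hle r hr
    have h2 := hGmono _ _ hr.1
    have h3 : h y = w y := by simp [hh]
    linarith
  have hyt : y ≠ t := by
    rintro rfl
    have h1 := hle r hr
    have h2 := hGup r hr.1 hr.2 y hst.le le_rfl hr.2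
    have h3 : h y ≤ w y := ht
    linarith
  have hyI : y ∈ Ioo s t := ⟨lt_of_le_of_ne hy.1 hys.symm, lt_of_le_of_ne hy.2 hyt⟩
  have hev : ∀ᶠ x in 𝓝 y, w y + (a + m * (y - s)) * (x - y) + m / 2 * (x - y) ^ 2
      + (G x - G y) ≤ w x := by
    filter_upwards [isOpen_Ioo.mem_nhds hyI] with x hx
    have h1 := hle x ⟨hx.1.le, hx.2.le⟩
    simp only [hh] at h1
    nlinarith
  set q : ℝ := a + m * (y - s) + g y with hq
  obtain ⟨hq0, hqM⟩ := hstrict q ⟨by nlinarith [(hgb y).1, mul_nonneg hm (sub_nonneg.2 hy.1)], by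
    have := (hgb y).2.trans (min_le_left _ _)
    have := mul_le_mul_of_nonneg_left (sub_le_sub_right hy.2 s) hm
    linarith⟩
  by_cases hyN : F y ≤ M
  · have := hw y hyI q m (by
      filter_upwards [hev] with x hx
      have := hGg x y
      rw [hq]; nlinarith)
    linarith
  -- At an exceptional point F y has no useful bound, but G supplies any curvature K, and q² K beats
  -- F y + C(1 + |q|) because q ≠ 0.
  · obtain ⟨K, hK⟩ := exists_nat_gt ((F y + C * (1 + |q|)) / q ^ 2)
    have hq2 : 0 < q ^ 2 := by positivity
    rw [div_lt_iff₀ hq2] at hK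
    have := hw y hyI q (m + K) (by
      filter_upwards [hev, hGN y ⟨hyI, hyN⟩ K] with x hx hx2
      rw [hq]; nlinarith)
    nlinarith [mul_nonneg hq2.le hm]

/-- This is the source of the exponent 1/3: 4(x² + xy + y²) − (x − y)² = 3(x + y)² ≥ 0. -/
lemma abs_sub_cube_le (x y : ℝ) : |x - y| ^ 3 ≤ 4 * |x ^ 3 - y ^ 3| := by
  wlog h : y ≤ x generalizing x y
  · rw [abs_sub_comm, abs_sub_comm (x ^ 3)]
    exact this y x (le_of_not_ge h)
  rw [abs_of_nonneg (sub_nonneg.2 h),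
    abs_of_nonneg (sub_nonneg.2 (Odd.strictMono_pow (by decide : Odd 3) |>.monotone h))]
  nlinarith [mul_nonneg (sub_nonneg.2 h) (sq_nonneg (x + y))]

lemma le_of_cube_le {x y : ℝ} (h : x ^ 3 ≤ y ^ 3) : x ≤ y :=
  (Odd.strictMono_pow (by decide : Odd 3)).le_iff_le.1 h

lemma cube_le {x y : ℝ} (h : x ≤ y) : x ^ 3 ≤ y ^ 3 :=
  (Odd.strictMono_pow (by decide : Odd 3)).monotone h

/-- Compare with a quadratic on [s, b] of very negative slope −A at s. All its slopes are at most
−1, so q² dominates 1 + |q| and the choice of m gives strictness. Taking s in the left half leaves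
length at least δ to absorb the oscillation 2B before b. -/
lemma IsRaySupersolution.exists_lower_lipschitz {w F : ℝ → ℝ} {C M a b : ℝ} (hab : a < b)
    (hw : IsRaySupersolution w F C (Ioo a b)) (hF : ∀ᵐ r, r ∈ Ioo a b → F r ≤ M)
    (hc : ContinuousOn w (Icc a b)) :
    ∃ L, ∀ s ∈ Icc a ((a + b) / 2), ∀ t ∈ Icc s b, - L * (t - s) ≤ w t - w s := by
  obtain ⟨B, hB⟩ := isCompact_Icc.exists_bound_of_continuousOn hc
  have hB0 : 0 ≤ B := (norm_nonneg _).trans (hB a ⟨le_rfl, hab.le⟩)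
  set δ := (b - a) / 2 with hδ
  have hδ0 : 0 < δ := by rw [hδ]; linarith
  set m := |M| + 2 * |C| + 1 with hm
  have hm0 : 0 ≤ m := by positivity
  refine ⟨2 + 2 * m * δ + 2 * B / δ, fun s hs t ht => ?_⟩
  set A := 2 + 2 * m * δ + 2 * B / δ with hA
  have hsb : s < b := by linarith [hs.2]
  have hsub : Ioo s b ⊆ Ioo a b := Ioo_subset_Ioo_left hs.1
  have hB' : 0 ≤ 2 * B / δ := by positivity
  have hT2 : b - s ≤ 2 * δ := by rw [hδ]; linarith [hs.1]
  have hT1 : δ ≤ b - s := by rw [hδ]; linarith [hs.2]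
  have hmT := mul_le_mul_of_nonneg_left hT2 hm0
  have := IsRaySupersolution.quadratic_le (w := w) (F := F) (C := C) (M := M) (a := -A) (m := m)
    (ε := 1) (fun r hr => hw r (hsub hr)) (hF.mono fun r h hr => h (hsub hr))
    (hc.mono (Icc_subset_Icc_left hs.1)) hsb hm0 one_pos (fun q hq => by
      have hq1 : q ≤ -1 := by nlinarith [hq.2]
      refine ⟨by linarith, ?_⟩
      rw [abs_of_neg (by linarith : q < 0), hm]
      have h1 : 1 ≤ -q := by linarith
      have h2 : -q ≤ q ^ 2 := by nlinarith
      have h3 : C * (1 + -q) ≤ |C| * (2 * q ^ 2) :=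
        mul_le_mul (le_abs_self C) (by linarith) (by linarith) (abs_nonneg _)
      nlinarith [le_abs_self M, abs_nonneg M,
        mul_nonneg (abs_nonneg M) (by linarith : 0 ≤ q ^ 2 - 1)])
    (by
      have h1 := abs_le.1 (hB s ⟨hs.1, hsb.le⟩)
      have h2 := abs_le.1 (hB b ⟨hab.le, le_rfl⟩)
      have h3 : 2 * B ≤ 2 * B / δ * (b - s) := by
        calc 2 * B = 2 * B / δ * δ := by field_simp
          _ ≤ _ := by gcongr
      nlinarith [mul_nonneg hm0 (by linarith : 0 ≤ b - s),
        mul_nonneg (mul_nonneg hm0 (by linarith : 0 ≤ b - s)) (by linarith : 0 ≤ 2 * δ - (b - s))])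
    (r := t) ht
  nlinarith [sq_nonneg (t - s), mul_nonneg hm0 (sq_nonneg (t - s))]

lemma TouchesBelow.abs_slope_le {w : ℝ → ℝ} {r p m L : ℝ} (h : TouchesBelow w r p m)
    (hL : ∀ᶠ x in 𝓝 r, w x ≤ w r + L * |x - r|) : |p| ≤ L := by
  have h1 : ∀ᶠ x in 𝓝 (0 : ℝ), p * x + m / 2 * x ^ 2 ≤ L * |x| := by
    have ht : Tendsto (fun x : ℝ => r + x) (𝓝 0) (𝓝 r) := by
      simpa using (continuous_const.add continuous_id).tendsto (x := (0 : ℝ)) (f := fun x => r + x)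
    filter_upwards [ht.eventually h, ht.eventually hL] with x hx1 hx2
    simp only [add_sub_cancel_left] at hx1 hx2
    linarith
  have key : ∀ σ : ℝ, |σ| = 1 → σ * p ≤ L := by
    intro σ hσ
    have h2 : ∀ᶠ x in 𝓝[>] (0 : ℝ), σ * p + m / 2 * x ≤ L := by
      have ht : Tendsto (fun x : ℝ => σ * x) (𝓝[>] 0) (𝓝 0) := by
        have : Tendsto (fun x : ℝ => σ * x) (𝓝 0) (𝓝 (σ * 0)) :=
          (continuous_const.mul continuous_id).tendsto 0
        rw [mul_zero] at this
        exact this.mono_left nhdsWithin_le_nhds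
      filter_upwards [ht.eventually h1, self_mem_nhdsWithin] with x hx hx0
      have hx0 : 0 < x := hx0
      rw [abs_mul, hσ, abs_of_pos hx0] at hx
      have hσ2 : σ ^ 2 = 1 := by rw [← sq_abs, hσ, one_pow]
      refine le_of_mul_le_mul_right ?_ hx0
      calc _ = p * (σ * x) + m / 2 * (σ ^ 2 * x ^ 2) := by rw [hσ2]; ring
        _ = p * (σ * x) + m / 2 * (σ * x) ^ 2 := by ring
        _ ≤ _ := by linarith
    refine le_of_tendsto (f := fun x : ℝ => σ * p + m / 2 * x) ?_ h2
    have : Tendsto (fun x : ℝ => σ * p + m / 2 * x) (𝓝 0) (𝓝 (σ * p + m / 2 * 0)) :=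
      Continuous.tendsto (by fun_prop) 0
    simp only [mul_zero, add_zero] at this
    exact this.mono_left nhdsWithin_le_nhds
  exact abs_le'.2 ⟨by simpa using key 1 (by simp), by simpa using key (-1) (by simp)⟩

/-- Compare w on [s, t] with a quadratic whose curvature is about 2M divided by the squared slope,
so that its slope cubed grows by at most a multiple of M(t − s). Its initial slope then bounds from
below every difference quotient at s. Slopes near 0 must be avoided, since Q² m > M fails there;
this forces the two cases, with threshold κ³ = 2M(t − s). -/
lemma IsRaySupersolution.slope_cube_ge {w F : ℝ → ℝ} {M a b : ℝ} (hM : 0 < M)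
    (hw : IsRaySupersolution w F 0 (Ioo a b)) (hF : ∀ᵐ r, r ∈ Ioo a b → F r ≤ M)
    (hc : ContinuousOn w (Icc a b)) {s r t : ℝ} (hs : a ≤ s) (hsr : s < r) (hrt : r ≤ t)
    (htb : t ≤ b) : slope w s t ^ 3 - 32 * M * (t - s) ≤ slope w s r ^ 3 := by
  have hst : s < t := hsr.trans_le hrt
  have hσ : 0 < t - s := sub_pos.2 hst
  obtain ⟨κ, hκ, hκ3⟩ : ∃ κ : ℝ, 0 < κ ∧ κ ^ 3 = 2 * M * (t - s) :=
    ⟨(2 * M * (t - s)) ^ ((1 : ℝ) / 3), by positivity, by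
      rw [← Real.rpow_natCast, ← Real.rpow_mul (by positivity)]; norm_num⟩
  set q := slope w s t with hq
  have hqt : w t = w s + q * (t - s) := by
    rw [hq, slope_def_field]; field_simp; ring
  have hκ3pos : 0 < κ ^ 3 := by positivity
  have main (α m ε : ℝ) (hm : 0 ≤ m) (hε : 0 < ε) (hαq : α + m * (t - s) ≤ q)
      (hstr : ∀ Q ∈ Icc α (α + m * (t - s) + ε), Q ≠ 0 ∧ M < Q ^ 2 * m) :
      α ^ 3 ≤ slope w s r ^ 3 := by
    have hsub : Ioo s t ⊆ Ioo a b := Ioo_subset_Ioo hs htb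
    have := IsRaySupersolution.quadratic_le (w := w) (F := F) (C := 0) (M := M) (a := α) (m := m)
      (ε := ε) (fun r hr => hw r (hsub hr)) (hF.mono fun r h hr => h (hsub hr))
      (hc.mono (Icc_subset_Icc hs htb)) hst hm hε (by simpa using hstr)
      (by rw [hqt]; nlinarith [mul_nonneg hm (sq_nonneg (t - s))]) (r := r) ⟨hsr.le, hrt⟩
    refine cube_le ?_
    rw [slope_def_field, le_div_iff₀ (sub_pos.2 hsr)]
    nlinarith [mul_nonneg hm (sq_nonneg (r - s))]
  have cub (x : ℝ) (h0 : 0 ≤ x) (h1 : x ≤ 1) : (1 + x) ^ 3 ≤ 1 + 7 * x := by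
    nlinarith [mul_nonneg h0 (sub_nonneg.2 h1), mul_nonneg (mul_nonneg h0 h0) (sub_nonneg.2 h1)]
  -- Large positive slope: α³ = q³ − 7κ³ ≥ κ³, and (1 + x)³ ≤ 1 + 7x on [0, 1] shows that the final
  -- slope α(1 + κ³/α³) is at most q.
  rcases le_or_gt (8 * κ ^ 3) (q ^ 3) with h8 | h8
  · obtain ⟨α, hα, hα3⟩ : ∃ α : ℝ, 0 < α ∧ α ^ 3 = q ^ 3 - 7 * κ ^ 3 :=
      ⟨(q ^ 3 - 7 * κ ^ 3) ^ ((1 : ℝ) / 3), Real.rpow_pos_of_pos (by linarith) _, by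
        rw [← Real.rpow_natCast, ← Real.rpow_mul (by linarith)]; norm_num⟩
    have hx : κ ^ 3 / α ^ 3 ≤ 1 := (div_le_one (by positivity)).2 (by linarith)
    have h1 := main α (2 * M / α ^ 2) 1 (by positivity) one_pos (le_of_cube_le (by
      have : α + 2 * M / α ^ 2 * (t - s) = α * (1 + κ ^ 3 / α ^ 3) := by rw [hκ3]; field_simp
      rw [this, mul_pow]
      calc α ^ 3 * (1 + κ ^ 3 / α ^ 3) ^ 3 ≤ α ^ 3 * (1 + 7 * (κ ^ 3 / α ^ 3)) := by
            gcongr; exact cub _ (by positivity) hx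
        _ = α ^ 3 + 7 * κ ^ 3 := by field_simp
        _ = q ^ 3 := by linarith)) fun Q hQ => by
      have hQ0 : 0 < Q := hα.trans_le hQ.1
      refine ⟨hQ0.ne', ?_⟩
      calc M < α ^ 2 * (2 * M / α ^ 2) := by field_simp; linarith
        _ ≤ Q ^ 2 * (2 * M / α ^ 2) := by gcongr; exact hQ.1
    linarith
  -- Otherwise use only negative slopes, ending at β ≤ −κ. The margin κ/4 keeps |Q| ≥ 3|β|/4, so Q²
  -- m ≥ 9M/8. The losses 9κ³ (from q to β) and 7κ³ (from β to the initial slope) add up to 16κ³ =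
  -- 32M(t − s).
  · set β := min q (-κ) with hβ
    have hβκ : β ≤ -κ := min_le_right _ _
    have hβ0 : β < 0 := by linarith
    have hβ3 : q ^ 3 - 9 * κ ^ 3 ≤ β ^ 3 := by
      rcases min_choice q (-κ) with h | h <;> rw [hβ, h]
      · linarith
      · have : (-κ) ^ 3 = -κ ^ 3 := by ring
        linarith
    have hβκ3 : κ ^ 3 ≤ (-β) ^ 3 := cube_le (by linarith)
    have hnβ : 0 < -β := by linarith
    have hx : κ ^ 3 / (-β) ^ 3 ≤ 1 := (div_le_one (by positivity)).2 hβκ3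
    have hβne : β ≠ 0 := hβ0.ne
    have hβ2 : 0 < β ^ 2 := by positivity
    have h1 := main (β - 2 * M / β ^ 2 * (t - s)) (2 * M / β ^ 2) (κ / 4) (by positivity)
      (by positivity) (by rw [sub_add_cancel]; exact min_le_left q (-κ)) fun Q hQ => by
      have hQ2 : Q ≤ β + κ / 4 := by linarith [hQ.2]
      refine ⟨by linarith, ?_⟩
      have h2 : 9 / 16 * β ^ 2 ≤ Q ^ 2 := by nlinarith
      calc M < (9 / 16 * β ^ 2) * (2 * M / β ^ 2) := by field_simp; linarith
        _ ≤ Q ^ 2 * (2 * M / β ^ 2) := by gcongr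
    have h2 : (β - 2 * M / β ^ 2 * (t - s)) ^ 3 = - ((-β) ^ 3 * (1 + κ ^ 3 / (-β) ^ 3) ^ 3) := by
      rw [hκ3, ← mul_pow]
      have : (-β) * (1 + 2 * M * (t - s) / (-β) ^ 3) = - (β - 2 * M / β ^ 2 * (t - s)) := by
        field_simp; ring
      rw [this]; ring
    have h3 : (-β) ^ 3 * (1 + κ ^ 3 / (-β) ^ 3) ^ 3 ≤ (-β) ^ 3 + 7 * κ ^ 3 := by
      calc _ ≤ (-β) ^ 3 * (1 + 7 * (κ ^ 3 / (-β) ^ 3)) := by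
            gcongr; exact cub _ (by positivity) hx
        _ = _ := by field_simp; ring
    have h4 : (-β) ^ 3 = - β ^ 3 := by ring
    linarith

lemma IsRaySupersolution.comp_neg {w F : ℝ → ℝ} {C : ℝ} {a b : ℝ}
    (hw : IsRaySupersolution w F C (Ioo a b)) :
    IsRaySupersolution (fun x => w (-x)) (fun x => F (-x)) C (Ioo (-b) (-a)) := by
  intro r hr p m h
  have := hw (-r) ⟨by linarith [hr.2], by linarith [hr.1]⟩ (-p) m (by
    have ht : Tendsto (fun x : ℝ => -x) (𝓝 (-r)) (𝓝 r) := by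
      simpa using (continuous_neg.tendsto (-r))
    filter_upwards [ht.eventually h] with x hx
    simp only [neg_neg] at hx
    calc _ = w (-r) + p * (-x - r) + m / 2 * (-x - r) ^ 2 := by ring
      _ ≤ _ := hx)
  simpa using this

lemma slope_cube_close {w F₁ F₂ : ℝ → ℝ} {M a b : ℝ} (hM : 0 < M)
    (h₁ : IsRaySupersolution w F₁ 0 (Ioo a b)) (hF₁ : ∀ᵐ r, r ∈ Ioo a b → F₁ r ≤ M)
    (h₂ : IsRaySupersolution (-w) F₂ 0 (Ioo a b)) (hF₂ : ∀ᵐ r, r ∈ Ioo a b → F₂ r ≤ M)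
    (hc : ContinuousOn w (Icc a b)) {x y z : ℝ} (hx : x ∈ Icc a b) (hy : y ∈ Icc a b)
    (hz : z ∈ Icc a b) (hxy : x ≠ y) (hxz : x ≠ z) :
    |slope w x y ^ 3 - slope w x z ^ 3| ≤ 64 * M * (|x - y| + |x - z|) := by
  have right {s r t : ℝ} (hs : a ≤ s) (hsr : s < r) (hrt : r ≤ t) (htb : t ≤ b) :
      |slope w s r ^ 3 - slope w s t ^ 3| ≤ 32 * M * (t - s) := by
    have e1 := h₁.slope_cube_ge hM hF₁ hc hs hsr hrt htb
    have e2 := h₂.slope_cube_ge hM hF₂ hc.neg hs hsr hrt htb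
    simp only [slope_neg_fun, Pi.neg_apply] at e2
    rw [Odd.neg_pow (by decide), Odd.neg_pow (by decide)] at e2
    rw [abs_le]; constructor <;> linarith
  have left {s r t : ℝ} (hs : a ≤ s) (hsr : s ≤ r) (hrt : r < t) (htb : t ≤ b) :
      |slope w t r ^ 3 - slope w t s ^ 3| ≤ 32 * M * (t - s) := by
    have hae {F : ℝ → ℝ} (hF : ∀ᵐ r, r ∈ Ioo a b → F r ≤ M) :
        ∀ᵐ r, r ∈ Ioo (-b) (-a) → F (-r) ≤ M := by
      filter_upwards [(Measure.measurePreserving_neg volume).quasiMeasurePreserving.ae hF]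
        with r hr h
      exact hr ⟨by linarith [h.2], by linarith [h.1]⟩
    have hc' : ContinuousOn (fun x => w (-x)) (Icc (-b) (-a)) :=
      hc.comp continuous_neg.continuousOn fun x hx => ⟨by linarith [hx.2], by linarith [hx.1]⟩
    have hsl (u v : ℝ) : slope (fun x => w (-x)) (-u) (-v) = - slope w u v := by
      rw [slope_def_field, slope_def_field, neg_neg, neg_neg, ← div_neg]; ring_nf
    have e1 := h₁.comp_neg.slope_cube_ge hM (hae hF₁) hc' (s := -t) (r := -r) (t := -s)
      (by linarith) (by linarith) (by linarith) (by linarith)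
    have e2 := h₂.comp_neg.slope_cube_ge hM (hae hF₂) hc'.neg (s := -t) (r := -r) (t := -s)
      (by linarith) (by linarith) (by linarith) (by linarith)
    have hsl2 (u v : ℝ) : slope (fun x => (-w) (-x)) (-u) (-v) = slope w u v := by
      rw [slope_def_field, slope_def_field, Pi.neg_apply, Pi.neg_apply, neg_neg, neg_neg,
        ← neg_div_neg_eq]
      ring_nf
    rw [hsl, hsl, Odd.neg_pow (by decide), Odd.neg_pow (by decide)] at e1
    rw [hsl2, hsl2] at e2
    rw [abs_le]; constructor <;> linarith
  -- With x between y and z, the chord from y to z shares an endpoint with both chords at x; passing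
  -- through it doubles 32 to 64.
  have opp {y x z : ℝ} (hy : a ≤ y) (hyx : y < x) (hxz : x < z) (hz : z ≤ b) :
      |slope w x y ^ 3 - slope w x z ^ 3| ≤ 64 * M * (z - y) := by
    have e1 := right hy hyx hxz.le hz
    have e2 := left hy hyx.le hxz hz
    rw [slope_comm w x y, slope_comm w x z]
    rw [slope_comm w z y] at e2
    rw [abs_le] at *; constructor <;> linarith
  rcases lt_or_gt_of_ne hxy with h1 | h1 <;> rcases lt_or_gt_of_ne hxz with h2 | h2
  · rw [abs_of_neg (sub_neg.2 h1), abs_of_neg (sub_neg.2 h2)]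
    rcases le_total y z with h | h
    · have := right hx.1 h1 h hz.2
      nlinarith
    · have := right hx.1 h2 h hy.2
      rw [abs_sub_comm] at this
      nlinarith
  · rw [abs_of_neg (sub_neg.2 h1), abs_of_pos (sub_pos.2 h2), abs_sub_comm]
    have := opp hz.1 h2 h1 hy.2
    linarith
  · rw [abs_of_pos (sub_pos.2 h1), abs_of_neg (sub_neg.2 h2)]
    have := opp hy.1 h1 h2 hz.2
    linarith
  · rw [abs_of_pos (sub_pos.2 h1), abs_of_pos (sub_pos.2 h2)]
    rcases le_total y z with h | h
    · have := left hy.1 h h2 hx.2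
      rw [abs_sub_comm] at this
      nlinarith
    · have := left hz.1 h h1 hx.2
      nlinarith

/-- The difference quotients at x are Cauchy because their cubes are. In the limit z → x the chord
from x to y has slope cubed within K|x − y| of both D(x)³ and D(y)³; `abs_sub_cube_le` turns the
resulting 2K into 8K. -/
lemma exists_deriv_of_slope_cube_close {w : ℝ → ℝ} {K a b : ℝ} (hab : a < b)
    (h : ∀ x ∈ Icc a b, ∀ y ∈ Icc a b, ∀ z ∈ Icc a b, x ≠ y → x ≠ z →
      |slope w x y ^ 3 - slope w x z ^ 3| ≤ K * (|x - y| + |x - z|)) :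
    ∃ D : ℝ → ℝ, (∀ x ∈ Icc a b, HasDerivWithinAt w (D x) (Icc a b) x) ∧
      ∀ x ∈ Icc a b, ∀ y ∈ Icc a b, |D x - D y| ^ 3 ≤ 8 * K * |x - y| := by
  have hne {x : ℝ} (hx : x ∈ Icc a b) : (𝓝[Icc a b \ {x}] x).NeBot := by
    have : AccPt x (𝓟 (Icc a b)) := by
      have := (isPreconnected_Icc (a := a) (b := b)).preperfect_of_nontrivial
        (Set.nontrivial_of_mem_mem_ne (left_mem_Icc.2 hab.le) (right_mem_Icc.2 hab.le) hab.ne)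
      exact this x hx
    rwa [accPt_principal_iff_nhdsWithin] at this
  have hK : 0 ≤ K := by
    have h1 := h a ⟨le_rfl, hab.le⟩ b ⟨hab.le, le_rfl⟩ b ⟨hab.le, le_rfl⟩ hab.ne hab.ne
    have h2 : 0 < |a - b| := abs_pos.2 (sub_ne_zero.2 hab.ne)
    by_contra! h3
    have := mul_neg_of_neg_of_pos h3 (add_pos h2 h2)
    simp only [sub_self, abs_zero] at h1
    linarith
  have hdist {x : ℝ} {e : ℝ} (he : 0 < e) : ∀ᶠ y in 𝓝[Icc a b \ {x}] x, y ∈ Icc a b ∧ x ≠ y ∧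
      |x - y| < e := by
    filter_upwards [self_mem_nhdsWithin, nhdsWithin_le_nhds (Metric.ball_mem_nhds x he)]
      with y hy1 hy2
    exact ⟨hy1.1, fun h => hy1.2 h.symm, by rwa [abs_sub_comm]⟩
  have hlim (x : ℝ) : ∃ D, x ∈ Icc a b → Tendsto (slope w x) (𝓝[Icc a b \ {x}] x) (𝓝 D) := by
    by_cases hx : x ∈ Icc a b
    swap
    · exact ⟨0, fun h => absurd h hx⟩
    have := hne hx
    have hC : Cauchy (map (slope w x) (𝓝[Icc a b \ {x}] x)) := by
      rw [Metric.cauchy_iff]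
      refine ⟨this.map _, fun ε hε => ?_⟩
      set e := ε ^ 3 / (16 * (K + 1)) with he
      have he0 : 0 < e := by positivity
      refine ⟨_, image_mem_map (hdist he0), ?_⟩
      rintro _ ⟨y, hy, rfl⟩ _ ⟨z, hz, rfl⟩
      have h1 := h x hx y hy.1 z hz.1 hy.2.1 hz.2.1
      have h2 := abs_sub_cube_le (slope w x y) (slope w x z)
      have h3 : K * (|x - y| + |x - z|) ≤ K * (2 * e) := by
        gcongr; linarith [hy.2.2, hz.2.2]
      have h4 : 16 * (K + 1) * e = ε ^ 3 := by rw [he]; field_simp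
      rw [Real.dist_eq]
      by_contra! h5
      have := cube_le h5
      nlinarith
    obtain ⟨D, hD⟩ := cauchy_map_iff_exists_tendsto.1 hC
    exact ⟨D, fun _ => hD⟩
  choose D hD using hlim
  have hDs : ∀ x ∈ Icc a b, ∀ y ∈ Icc a b, x ≠ y → |slope w x y ^ 3 - D x ^ 3| ≤ K * |x - y| := by
    intro x hx y hy hxy
    have := hne hx
    have ht : Tendsto (fun z => |slope w x y ^ 3 - slope w x z ^ 3| - K * |x - z|)
        (𝓝[Icc a b \ {x}] x) (𝓝 (|slope w x y ^ 3 - D x ^ 3| - K * |x - x|)) := by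
      refine Tendsto.sub ((tendsto_const_nhds.sub ((hD x hx).pow 3)).abs) ?_
      exact (Continuous.tendsto (by fun_prop) x).mono_left nhdsWithin_le_nhds
    rw [sub_self, abs_zero, mul_zero, sub_zero] at ht
    refine le_of_tendsto ht ?_
    filter_upwards [hdist one_pos] with z hz
    have := h x hx y hy z hz.1 hxy hz.2.1
    linarith
  refine ⟨D, fun x hx => hasDerivWithinAt_iff_tendsto_slope.2 (hD x hx), fun x hx y hy => ?_⟩
  rcases eq_or_ne x y with rfl | hxy
  · simp
  have h1 := hDs x hx y hy hxy
  have h2 := hDs y hy x hx hxy.symm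
  rw [slope_comm, abs_sub_comm y] at h2
  have h3 := abs_sub_cube_le (D x) (D y)
  have h4 : |D x ^ 3 - D y ^ 3| ≤ 2 * K * |x - y| := by
    rw [abs_le] at *; constructor <;> linarith
  linarith

/-- On the left half of the interval w is Lipschitz, so touching slopes are bounded there and C(1 +
|p|) joins the right-hand side. The endpoint a is retained, which matters when a = 0 corresponds to
X₀. -/
lemma IsRaySupersolution.exists_deriv {w F₁ F₂ : ℝ → ℝ} {C M a b : ℝ} (hab : a < b)
    (hC : 0 ≤ C)
    (h₁ : IsRaySupersolution w F₁ C (Ioo a b)) (hF₁ : ∀ᵐ r, r ∈ Ioo a b → F₁ r ≤ M)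
    (h₂ : IsRaySupersolution (-w) F₂ C (Ioo a b)) (hF₂ : ∀ᵐ r, r ∈ Ioo a b → F₂ r ≤ M)
    (hc : ContinuousOn w (Icc a b)) :
    ∃ (D : ℝ → ℝ) (K : ℝ),
      (∀ x ∈ Icc a ((a + b) / 2), HasDerivWithinAt w (D x) (Icc a ((a + b) / 2)) x) ∧
      ∀ x ∈ Icc a ((a + b) / 2), ∀ y ∈ Icc a ((a + b) / 2), |D x - D y| ^ 3 ≤ K * |x - y| := by
  obtain ⟨L₁, hL₁⟩ := h₁.exists_lower_lipschitz hab hF₁ hc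
  obtain ⟨L₂, hL₂⟩ := h₂.exists_lower_lipschitz hab hF₂ hc.neg
  set c := (a + b) / 2 with hcdef
  have hac : a < c := by linarith
  have hcb : c ≤ b := by linarith
  set L := max |L₁| |L₂| with hL
  have hlip : ∀ x ∈ Icc a c, ∀ y ∈ Icc a c, |w x - w y| ≤ L * |x - y| := by
    intro x hx y hy
    wlog h : x ≤ y generalizing x y
    · rw [abs_sub_comm, abs_sub_comm x]
      exact this y hy x hx (le_of_not_ge h)
    have e1 := hL₁ x hx y ⟨h, hy.2.trans hcb⟩
    have e2 := hL₂ x hx y ⟨h, hy.2.trans hcb⟩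
    simp only [Pi.neg_apply] at e2
    rw [abs_sub_comm x, abs_of_nonneg (sub_nonneg.2 h)]
    have e3 : L₁ * (y - x) ≤ L * (y - x) :=
      mul_le_mul_of_nonneg_right ((le_abs_self _).trans (le_max_left _ _)) (sub_nonneg.2 h)
    have e4 : L₂ * (y - x) ≤ L * (y - x) :=
      mul_le_mul_of_nonneg_right ((le_abs_self _).trans (le_max_right _ _)) (sub_nonneg.2 h)
    rw [abs_le]; constructor <;> linarith
  have red {v F : ℝ → ℝ} (hv : IsRaySupersolution v F C (Ioo a b))
      (hlip : ∀ x ∈ Icc a c, ∀ y ∈ Icc a c, |v x - v y| ≤ L * |x - y|) :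
      IsRaySupersolution v (fun r => F r + C * (1 + L)) 0 (Ioo a c) := by
    intro r hr p m h
    have e1 := hv r (Ioo_subset_Ioo_right hcb hr) p m h
    have e2 := h.abs_slope_le (L := L) (by
      filter_upwards [isOpen_Ioo.mem_nhds hr] with x hx
      have := hlip x (Ioo_subset_Icc_self hx) r (Ioo_subset_Icc_self hr)
      linarith [(abs_le.1 this).2])
    have e3 : C * (1 + |p|) ≤ C * (1 + L) := by gcongr
    simp only [zero_mul, add_zero]
    linarith
  have hM : 0 < |M| + C * (1 + L) + 1 := by
    have : 0 ≤ L := (abs_nonneg _).trans (le_max_left _ _)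
    positivity
  have bd {F : ℝ → ℝ} (hF : ∀ᵐ r, r ∈ Ioo a b → F r ≤ M) :
      ∀ᵐ r, r ∈ Ioo a c → F r + C * (1 + L) ≤ |M| + C * (1 + L) + 1 := by
    filter_upwards [hF] with r hr h
    linarith [hr (Ioo_subset_Ioo_right hcb h), le_abs_self M]
  obtain ⟨D, hD1, hD2⟩ := exists_deriv_of_slope_cube_close hac fun x hx y hy z hz hxy hxz =>
    slope_cube_close hM (red h₁ hlip) (bd hF₁)
      (red h₂ fun x hx y hy => by
        simpa [abs_sub_comm, neg_add_eq_sub] using hlip x hx y hy) (bd hF₂)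
      (hc.mono (Icc_subset_Icc_right hcb)) hx hy hz hxy hxz
  exact ⟨D, _, hD1, hD2⟩

/-! ### Second-order Taylor expansion and restriction to lines. -/

section SecondOrder

variable {E : Type*} [NormedAddCommGroup E] [NormedSpace ℝ E]

/-- Second order Taylor expansion with Peano remainder. -/
lemma ContDiffAt.eventually_abs_taylor_two_le {T : E → ℝ} {Y : E} (hT : ContDiffAt ℝ 2 T Y)
    {ε : ℝ} (hε : 0 < ε) :
    ∀ᶠ X in 𝓝 Y, |T X - (T Y + fderiv ℝ T Y (X - Y) +
      1 / 2 * fderiv ℝ (fderiv ℝ T) Y (X - Y) (X - Y))| ≤ ε * ‖X - Y‖ ^ 2 := by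
  set A := fderiv ℝ T Y
  set B := fderiv ℝ (fderiv ℝ T) Y with hB
  have hsymm : ∀ v w, B v w = B w v := hT.isSymmSndFDerivAt (by simp)
  have hD : HasFDerivAt (fderiv ℝ T) B Y :=
    ((hT.fderiv_right (m := 1) (by norm_num)).differentiableAt (by norm_num)).hasFDerivAt
  have h1 : ∀ᶠ X in 𝓝 Y, ‖fderiv ℝ T X - A - B (X - Y)‖ ≤ ε * ‖X - Y‖ :=
    hD.isLittleO.def hε
  have h2 : ∀ᶠ X in 𝓝 Y, DifferentiableAt ℝ T X :=
    (hT.eventually (by simp)).mono fun X hX => hX.differentiableAt (by norm_num)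
  obtain ⟨δ, hδ, hb⟩ := Metric.eventually_nhds_iff_ball.1 (h1.and h2)
  set R : E → ℝ := fun X => T X - (T Y + A (X - Y) + 1 / 2 * B (X - Y) (X - Y)) with hR
  have hR' : ∀ X ∈ Metric.ball Y δ, HasFDerivAt R (fderiv ℝ T X - A - B (X - Y)) X := by
    intro X hX
    have hi : HasFDerivAt (fun X : E => X - Y) (ContinuousLinearMap.id ℝ E) X :=
      (hasFDerivAt_id X).sub_const Y
    have hA : HasFDerivAt (fun X => A (X - Y)) A X := A.hasFDerivAt.comp X hi
    have hBi : HasFDerivAt (fun X => B (X - Y)) B X := B.hasFDerivAt.comp X hi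
    have hBB := (hBi.clm_apply hi).const_mul (1 / 2 : ℝ)
    refine ((hb X hX).2.hasFDerivAt.sub ((hA.const_add (T Y)).add hBB)).congr_fderiv ?_
    ext v
    simp [hsymm v X, hsymm v Y]
    ring
  filter_upwards [Metric.ball_mem_nhds Y hδ] with X hX
  have hsub : Metric.closedBall Y ‖X - Y‖ ⊆ Metric.ball Y δ :=
    Metric.closedBall_subset_ball (by rwa [← dist_eq_norm])
  have := (convex_closedBall Y ‖X - Y‖).norm_image_sub_le_of_norm_hasFDerivWithin_le
    (f := R) (C := ε * ‖X - Y‖) (fun Z hZ => (hR' Z (hsub hZ)).hasFDerivWithinAt)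
    (fun Z hZ => ((hb Z (hsub hZ)).1).trans (by
      have : ‖Z - Y‖ ≤ ‖X - Y‖ := by simpa [dist_eq_norm] using hZ
      gcongr))
    (Metric.mem_closedBall_self (norm_nonneg _)) (y := X) (by simp [dist_eq_norm])
  have hRY : R Y = 0 := by simp [hR]
  rw [hRY, sub_zero, Real.norm_eq_abs] at this
  calc _ = |R X| := rfl
    _ ≤ _ := this
    _ = _ := by ring

lemma hasDerivAt_comp_line {T : E → ℝ} {Y Z : E} {t : ℝ}
    (h : DifferentiableAt ℝ T (Y + t • Z)) :
    HasDerivAt (fun t : ℝ => T (Y + t • Z)) (fderiv ℝ T (Y + t • Z) Z) t := by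
  have h1 : HasDerivAt (fun t : ℝ => Y + t • Z) Z t := by
    simpa using ((hasDerivAt_id t).smul_const Z).const_add Y
  exact h.hasFDerivAt.comp_hasDerivAt t h1

lemma hasDerivAt_fderiv_comp_line {T : E → ℝ} {Y Z : E} {t : ℝ}
    (h : ContDiffAt ℝ 2 T (Y + t • Z)) :
    HasDerivAt (fun t : ℝ => fderiv ℝ T (Y + t • Z) Z)
      (fderiv ℝ (fderiv ℝ T) (Y + t • Z) Z Z) t := by
  have h1 : HasDerivAt (fun t : ℝ => Y + t • Z) Z t := by
    simpa using ((hasDerivAt_id t).smul_const Z).const_add Y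
  have h2 := ((h.fderiv_right (m := 1) (by norm_num)).differentiableAt
    (by norm_num)).hasFDerivAt.comp_hasDerivAt t h1
  simpa using h2.clm_apply (hasDerivAt_const t Z)

lemma tendsto_line (Y Z : E) : Tendsto (fun t : ℝ => Y + t • Z) (𝓝 0) (𝓝 Y) := by
  have : Continuous fun t : ℝ => Y + t • Z := by fun_prop
  simpa using this.tendsto 0

/-- The first and second derivatives of `T` at `Y` in the direction `Z`, from those of its
restriction to a line. -/
lemma ContDiffAt.fderiv_eq_of_line {T : E → ℝ} {Y Z : E} (hT : ContDiffAt ℝ 2 T Y)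
    {g : ℝ → ℝ} {c : ℝ} (h1 : ∀ᶠ t in 𝓝 (0 : ℝ), HasDerivAt (fun t : ℝ => T (Y + t • Z)) (g t) t)
    (h2 : HasDerivAt g c 0) :
    fderiv ℝ T Y Z = g 0 ∧ fderiv ℝ (fderiv ℝ T) Y Z Z = c := by
  have hev : ∀ᶠ t in 𝓝 (0 : ℝ), g t = fderiv ℝ T (Y + t • Z) Z := by
    filter_upwards [h1, (tendsto_line Y Z).eventually (hT.eventually (by simp))] with t ht ht2
    exact ht.unique (hasDerivAt_comp_line (ht2.differentiableAt (by norm_num)))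
  refine ⟨by simpa using hev.self_of_nhds.symm, ?_⟩
  have hT' : ContDiffAt ℝ 2 T (Y + (0 : ℝ) • Z) := by simpa using hT
  have := (hasDerivAt_fderiv_comp_line hT').congr_of_eventuallyEq hev
  simpa using this.unique h2

end SecondOrder

/-! ### Enlarging the class of viscosity test functions. -/

section Viscosity

variable {d : ℕ}

lemma fderiv_neg_eq (φ : EuclideanSpace ℝ (Fin d) → ℝ) : fderiv ℝ (-φ) = - fderiv ℝ φ := by
  ext1 X; exact fderiv_neg

lemma gradient_neg_eq (φ : EuclideanSpace ℝ (Fin d) → ℝ) (X : EuclideanSpace ℝ (Fin d)) :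
    gradient (-φ) X = - gradient φ X := by
  simp [gradient, fderiv_neg_eq]

lemma infinityLaplacian_neg (η : EuclideanSpace ℝ (Fin d) → ℝ) (Y : EuclideanSpace ℝ (Fin d)) :
    infinityLaplacian (-η) Y = - infinityLaplacian η Y := by
  rw [infinityLaplacian, infinityLaplacian, fderiv_neg_eq, gradient_neg_eq, fderiv_neg]
  simp

lemma IsViscositySubsolution.neg {u f : EuclideanSpace ℝ (Fin d) → ℝ}
    {U : Set (EuclideanSpace ℝ (Fin d))} (h : IsViscositySubsolution u f U) :
    IsViscositySupersolution (-u) (-f) U := by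
  intro Y hY η hη hmin
  have := h Y hY (-η) hη.neg (by
    have := hmin.neg
    refine this.congr (Eventually.of_forall fun X => ?_)
    simp [add_comm])
  rw [infinityLaplacian_neg] at this
  simp only [Pi.neg_apply]
  linarith

lemma infinityLaplacian_quadratic (c : ℝ) (A : EuclideanSpace ℝ (Fin d) →L[ℝ] ℝ)
    (B : EuclideanSpace ℝ (Fin d) →L[ℝ] EuclideanSpace ℝ (Fin d) →L[ℝ] ℝ)
    (hB : ∀ v w, B v w = B w v) (Y : EuclideanSpace ℝ (Fin d)) :
    infinityLaplacian (fun X => c + A (X - Y) + 1 / 2 * B (X - Y) (X - Y)) Y =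
      B ((InnerProductSpace.toDual ℝ _).symm A) ((InnerProductSpace.toDual ℝ _).symm A) := by
  have h1 : fderiv ℝ (fun X => c + A (X - Y) + 1 / 2 * B (X - Y) (X - Y)) =
      fun X => A + B (X - Y) := by
    ext1 X
    have hi : HasFDerivAt (fun X : EuclideanSpace ℝ (Fin d) => X - Y)
        (ContinuousLinearMap.id ℝ _) X := (hasFDerivAt_id X).sub_const Y
    have hA : HasFDerivAt (fun X => A (X - Y)) A X := A.hasFDerivAt.comp X hi
    have hBi : HasFDerivAt (fun X => B (X - Y)) B X := B.hasFDerivAt.comp X hi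
    have hBB := (hBi.clm_apply hi).const_mul (1 / 2 : ℝ)
    refine (((hA.const_add c).add hBB).congr_fderiv ?_).fderiv
    ext v
    simp [hB v X, hB v Y]
    ring
  have h2 : HasFDerivAt (fun X => A + B (X - Y)) B Y := by
    have hi : HasFDerivAt (fun X : EuclideanSpace ℝ (Fin d) => X - Y)
        (ContinuousLinearMap.id ℝ _) Y := (hasFDerivAt_id Y).sub_const Y
    exact (B.hasFDerivAt.comp Y hi).const_add A
  rw [infinityLaplacian, gradient, h1, h2.fderiv]
  simp

/-- Second order jets from below may be used as tests. -/
lemma IsViscositySupersolution.quadratic_test {u f : EuclideanSpace ℝ (Fin d) → ℝ}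
    {U : Set (EuclideanSpace ℝ (Fin d))} (h : IsViscositySupersolution u f U)
    {Y : EuclideanSpace ℝ (Fin d)} (hY : Y ∈ U) (A : EuclideanSpace ℝ (Fin d) →L[ℝ] ℝ)
    (B : EuclideanSpace ℝ (Fin d) →L[ℝ] EuclideanSpace ℝ (Fin d) →L[ℝ] ℝ)
    (hB : ∀ v w, B v w = B w v)
    (hu : ∀ ε > 0, ∀ᶠ X in 𝓝 Y,
      u Y + A (X - Y) + 1 / 2 * B (X - Y) (X - Y) - ε * ‖X - Y‖ ^ 2 ≤ u X) :
    B ((InnerProductSpace.toDual ℝ _).symm A) ((InnerProductSpace.toDual ℝ _).symm A) ≤ f Y := by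
  set P := (InnerProductSpace.toDual ℝ _).symm A with hP
  -- Lowering the Hessian by 2ε turns the approximate touching into exact touching by a polynomial
  -- with the same gradient; afterwards ε tends to 0.
  have key : ∀ ε > 0, B P P - 2 * ε * ‖P‖ ^ 2 ≤ f Y := by
    intro ε hε
    obtain ⟨I, hI⟩ : ∃ I : EuclideanSpace ℝ (Fin d) →L[ℝ] EuclideanSpace ℝ (Fin d) →L[ℝ] ℝ,
      ∀ v w, I v w = inner ℝ v w := ⟨innerSL ℝ, fun _ _ => rfl⟩
    set B' := B - (2 * ε) • I with hB'
    have hB'a (v w) : B' v w = B v w - 2 * ε * inner ℝ v w := by simp [hB', hI]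
    have hs (v w) : B' v w = B' w v := by rw [hB'a, hB'a, hB, real_inner_comm]
    have := h Y hY (fun X => u Y + A (X - Y) + 1 / 2 * B' (X - Y) (X - Y)) (by fun_prop) (by
      filter_upwards [hu ε hε] with X hX
      simp only [hB'a, real_inner_self_eq_norm_sq, sub_self, map_zero]
      linarith)
    rw [infinityLaplacian_quadratic _ _ _ hs, ← hP, hB'a, real_inner_self_eq_norm_sq] at this
    exact this
  have ht : Tendsto (fun ε : ℝ => B P P - 2 * ε * ‖P‖ ^ 2) (𝓝[>] 0) (𝓝 (B P P)) := by
    have : Continuous fun ε : ℝ => B P P - 2 * ε * ‖P‖ ^ 2 := by fun_prop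
    have := this.tendsto 0
    simp only [mul_zero, zero_mul, sub_zero] at this
    exact this.mono_left nhdsWithin_le_nhds
  exact le_of_tendsto ht (by filter_upwards [self_mem_nhdsWithin] with ε hε using key ε hε)

/-- Functions of class `C²` near the point may be used as tests. -/
lemma IsViscositySupersolution.contDiffAt_test {u f : EuclideanSpace ℝ (Fin d) → ℝ}
    {U : Set (EuclideanSpace ℝ (Fin d))} (h : IsViscositySupersolution u f U)
    {Y : EuclideanSpace ℝ (Fin d)} (hY : Y ∈ U) {T : EuclideanSpace ℝ (Fin d) → ℝ}
    (hT : ContDiffAt ℝ 2 T Y) (hTY : T Y = u Y) (hle : ∀ᶠ X in 𝓝 Y, T X ≤ u X) :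
    fderiv ℝ (fderiv ℝ T) Y (gradient T Y) (gradient T Y) ≤ f Y := by
  refine h.quadratic_test hY _ _ (hT.isSymmSndFDerivAt (by simp)) fun ε hε => ?_
  filter_upwards [hT.eventually_abs_taylor_two_le hε, hle] with X h1 h2
  have := (abs_le.1 h1).1
  rw [← hTY]
  linarith

/-! ### Reduction to one-dimensional inequalities along rays. -/

section Ray

variable {E : Type*} [NormedAddCommGroup E] [InnerProductSpace ℝ E]

lemma hasDerivAt_norm_add_smul {x z : E} {t : ℝ} (h : x + t • z ≠ 0) :
    HasDerivAt (fun t : ℝ => ‖x + t • z‖) ((inner ℝ x z + t * ‖z‖ ^ 2) / ‖x + t • z‖) t := by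
  have h0 : HasDerivAt (fun t : ℝ => x + t • z) z t := by
    simpa using ((hasDerivAt_id t).smul_const z).const_add x
  have h1 : HasDerivAt (fun t : ℝ => ‖x + t • z‖ ^ 2) (2 * inner ℝ (x + t • z) z) t := h0.norm_sq
  have h2 := h1.sqrt (by positivity)
  simp only [Real.sqrt_sq (norm_nonneg _)] at h2
  convert h2 using 1
  rw [inner_add_left, real_inner_smul_left, real_inner_self_eq_norm_sq]
  field_simp

end Ray

/-- A quadratic touching `r ↦ u (X₀ + r θ)` from below yields a `C²` function touching `u` from
below, and hence an inequality for its coefficients. -/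
lemma IsViscositySupersolution.ray_test {u f φ : EuclideanSpace ℝ (Fin d) → ℝ} {ψ : ℝ → ℝ}
    {U V : Set (EuclideanSpace ℝ (Fin d))} (h : IsViscositySupersolution u f U)
    (hVo : IsOpen V) (hVU : V ⊆ U) (hφ : ContDiffOn ℝ 2 φ V)
    {X₀ θ : EuclideanSpace ℝ (Fin d)} (hu : ∀ X ∈ V, u X = φ X + ψ ‖X - X₀‖) (hθ : ‖θ‖ = 1)
    {r p m : ℝ} (hr : 0 < r) (hY : X₀ + r • θ ∈ V)
    (ht : TouchesBelow (fun x => u (X₀ + x • θ)) r p m) {P : EuclideanSpace ℝ (Fin d)}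
    (hP : P = gradient φ (X₀ + r • θ) + (p - inner ℝ (gradient φ (X₀ + r • θ)) θ) • θ) :
    fderiv ℝ (fderiv ℝ φ) (X₀ + r • θ) P P
      + (m - fderiv ℝ (fderiv ℝ φ) (X₀ + r • θ) θ θ) * p ^ 2
      + (p - inner ℝ (gradient φ (X₀ + r • θ)) θ) *
        ((‖gradient φ (X₀ + r • θ)‖ ^ 2 - inner ℝ (gradient φ (X₀ + r • θ)) θ ^ 2) / r)
      ≤ f (X₀ + r • θ) := by
  set Y := X₀ + r • θ with hYdef
  have hφC : ∀ X ∈ V, ContDiffAt ℝ 2 φ X := fun X hX => hφ.contDiffAt (hVo.mem_nhds hX)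
  have hYr : ‖Y - X₀‖ = r := by simp [hYdef, norm_smul, hθ, abs_of_pos hr]
  have hline : ∀ x : ℝ, X₀ + x • θ = Y + (x - r) • θ := by
    intro x; rw [hYdef]; module
  -- On the ray, φ + κ is exactly the given quadratic. Since u − T = (ψ − κ)(‖X − X₀‖) is radial,
  -- touching along the ray implies touching in a full neighbourhood of Y.
  set κ : ℝ → ℝ := fun x => u Y + p * (x - r) + m / 2 * (x - r) ^ 2 - φ (Y + (x - r) • θ) with hκ
  set κ₁ : ℝ → ℝ := fun x => p + m * (x - r) - fderiv ℝ φ (Y + (x - r) • θ) θ with hκ₁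
  set T : EuclideanSpace ℝ (Fin d) → ℝ := fun X => φ X + κ ‖X - X₀‖ with hT
  have hκsmooth : ContDiffAt ℝ 2 κ r := by
    have h1 : ContDiffAt ℝ 2 (fun x : ℝ => φ (Y + (x - r) • θ)) r := by
      refine ContDiffAt.comp (g := φ) (f := fun x : ℝ => Y + (x - r) • θ) r ?_ (by fun_prop)
      simpa using hφC Y hY
    exact ContDiffAt.sub (by fun_prop) h1
  have hTsmooth : ContDiffAt ℝ 2 T Y := by
    refine (hφC Y hY).add ?_
    refine ContDiffAt.comp (g := κ) (f := fun X => ‖X - X₀‖) Y (by simpa [hYr] using hκsmooth) ?_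
    refine ContDiffAt.norm ℝ (by fun_prop) ?_
    rw [← norm_ne_zero_iff, hYr]; exact hr.ne'
  have hTY : T Y = u Y := by simp [hT, hκ, hYr]
  have hcont : Tendsto (fun X => ‖X - X₀‖) (𝓝 Y) (𝓝 r) := by
    rw [← hYr]; exact Continuous.tendsto (by fun_prop) Y
  have hcont2 : Tendsto (fun x : ℝ => X₀ + x • θ) (𝓝 r) (𝓝 Y) :=
    Continuous.tendsto (by fun_prop) r
  have hle : ∀ᶠ X in 𝓝 Y, T X ≤ u X := by
    filter_upwards [hVo.mem_nhds hY, hcont.eventually ht,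
      hcont.eventually (hcont2.eventually (hVo.mem_nhds hY)),
      hcont.eventually (lt_mem_nhds hr)] with X hX h1 h2 h3
    have h4 := hu _ h2
    rw [show ‖X₀ + ‖X - X₀‖ • θ - X₀‖ = ‖X - X₀‖ by simp [norm_smul, hθ]] at h4
    have h5 := hu X hX
    simp only [hT, hκ, ← hline]
    linarith
  have htest := h.contDiffAt_test (hVU hY) hTsmooth hTY hle
  -- the derivatives of `T` along the line through `Y` in direction `Z`
  have hκd : ∀ᶠ x in 𝓝 r, HasDerivAt κ (κ₁ x) x := by
    filter_upwards [hcont2.eventually (hVo.mem_nhds hY)] with x hx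
    rw [hline] at hx
    have h1 := (hasDerivAt_comp_line ((hφC _ hx).differentiableAt (by norm_num))).comp x
      ((hasDerivAt_id x).sub_const r)
    have h2 : HasDerivAt (fun x : ℝ => u Y + p * (x - r) + m / 2 * (x - r) ^ 2)
        (p + m * (x - r)) x := by
      have h3 := (hasDerivAt_id x).sub_const r
      refine (((h3.const_mul p).const_add (u Y)).add ((h3.pow 2).const_mul (m / 2))).congr_deriv ?_
      simp; ring
    exact (h2.sub h1).congr_deriv (by simp [hκ₁])
  have hκ₁d : HasDerivAt κ₁ (m - fderiv ℝ (fderiv ℝ φ) Y θ θ) r := by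
    have h0 : ContDiffAt ℝ 2 φ (Y + (r - r) • θ) := by simpa using hφC Y hY
    have h1 := (hasDerivAt_fderiv_comp_line h0).comp (h := fun x => x - r) r
      ((hasDerivAt_id r).sub_const r)
    have h2 : HasDerivAt (fun x : ℝ => p + m * (x - r)) m r := by
      simpa using (((hasDerivAt_id r).sub_const r).const_mul m).const_add p
    exact (h2.sub h1).congr_deriv (by simp)
  have hdir (Z : EuclideanSpace ℝ (Fin d)) :
      fderiv ℝ T Y Z = fderiv ℝ φ Y Z + κ₁ r * inner ℝ θ Z ∧
      fderiv ℝ (fderiv ℝ T) Y Z Z = fderiv ℝ (fderiv ℝ φ) Y Z Z +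
        ((m - fderiv ℝ (fderiv ℝ φ) Y θ θ) * inner ℝ θ Z ^ 2 +
          κ₁ r * ((‖Z‖ ^ 2 - inner ℝ θ Z ^ 2) / r)) := by
    -- The chain rule is applied to κ ∘ ρ, with ρ'(0) = ⟨θ, Z⟩ and ρ''(0) = (‖Z‖² − ⟨θ, Z⟩²)/r.
    set ρ : ℝ → ℝ := fun t => ‖r • θ + t • Z‖ with hρ
    have hρ0 : ρ 0 = r := by simp [hρ, norm_smul, hθ, abs_of_pos hr]
    have hρc : Tendsto ρ (𝓝 0) (𝓝 r) := by
      have : Continuous ρ := by fun_prop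
      rw [← hρ0]; exact this.tendsto 0
    have hρe : ∀ t : ℝ, ‖Y + t • Z - X₀‖ = ρ t := by
      intro t; simp only [hρ, hYdef]; congr 1; module
    have hρd : ∀ᶠ t in 𝓝 (0 : ℝ), HasDerivAt ρ ((r * inner ℝ θ Z + t * ‖Z‖ ^ 2) / ρ t) t := by
      filter_upwards [hρc.eventually (lt_mem_nhds hr)] with t ht
      have := hasDerivAt_norm_add_smul (norm_ne_zero_iff.1 (ne_of_gt ht) : r • θ + t • Z ≠ 0)
      rwa [real_inner_smul_left] at this
    have key := hTsmooth.fderiv_eq_of_line (Z := Z)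
      (g := fun t => fderiv ℝ φ (Y + t • Z) Z + κ₁ (ρ t) * ((r * inner ℝ θ Z + t * ‖Z‖ ^ 2) / ρ t))
      (c := fderiv ℝ (fderiv ℝ φ) Y Z Z +
        ((m - fderiv ℝ (fderiv ℝ φ) Y θ θ) * inner ℝ θ Z ^ 2 +
          κ₁ r * ((‖Z‖ ^ 2 - inner ℝ θ Z ^ 2) / r))) (by
        filter_upwards [hρd, hρc.eventually hκd,
          (tendsto_line Y Z).eventually (hVo.mem_nhds hY)] with t h1 h2 h3
        have h4 := hasDerivAt_comp_line ((hφC _ h3).differentiableAt (by norm_num))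
        simp only [hT, hρe]
        exact h4.add (h2.comp t h1)) (by
        have h1 := hρd.self_of_nhds
        have h0 : ContDiffAt ℝ 2 φ (Y + (0 : ℝ) • Z) := by simpa using hφC Y hY
        have h2 := hasDerivAt_fderiv_comp_line h0
        have h3 : HasDerivAt (fun t : ℝ => r * inner ℝ θ Z + t * ‖Z‖ ^ 2) (‖Z‖ ^ 2) 0 := by
          simpa using ((hasDerivAt_id (0 : ℝ)).mul_const (‖Z‖ ^ 2)).const_add (r * inner ℝ θ Z)
        have h4 := h3.div h1 (by rw [hρ0]; exact hr.ne')
        have h5 : HasDerivAt κ₁ (m - fderiv ℝ (fderiv ℝ φ) Y θ θ) (ρ 0) := by rwa [hρ0]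
        refine (h2.add ((h5.comp 0 h1).mul h4)).congr_deriv ?_
        simp only [hρ0, zero_smul, add_zero, zero_mul, Function.comp, Pi.div_apply]
        field_simp)
    refine ⟨key.1.trans ?_, key.2⟩
    simp only [hρ0, zero_smul, add_zero, zero_mul]
    field_simp
  have hκ₁r : κ₁ r = p - inner ℝ (gradient φ Y) θ := by simp [hκ₁, inner_gradient_left]
  have hgrad : gradient T Y = P := by
    refine ext_inner_right ℝ fun Z => ?_
    rw [inner_gradient_left, (hdir Z).1, hκ₁r, hP, inner_add_left, real_inner_smul_left,
      inner_gradient_left, inner_gradient_left]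
  have hθP : inner ℝ θ P = p := by
    rw [hP, inner_add_right, real_inner_smul_right, real_inner_self_eq_norm_sq, hθ,
      real_inner_comm]
    ring
  have hPP : ‖P‖ ^ 2 - p ^ 2 = ‖gradient φ Y‖ ^ 2 - inner ℝ (gradient φ Y) θ ^ 2 := by
    rw [hP, norm_add_sq_real, real_inner_smul_right, norm_smul, mul_pow, hθ, Real.norm_eq_abs,
      sq_abs]
    ring
  rw [hgrad, (hdir P).2, hκ₁r, hθP, hPP] at htest
  linarith

/-- Along a ray on which `φ` is controlled, `u` satisfies a one-dimensional inequality. -/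
lemma IsViscositySupersolution.isRaySupersolution {u f φ : EuclideanSpace ℝ (Fin d) → ℝ}
    {ψ : ℝ → ℝ} {U V : Set (EuclideanSpace ℝ (Fin d))} (h : IsViscositySupersolution u f U)
    (hVo : IsOpen V) (hVU : V ⊆ U) (hφ : ContDiffOn ℝ 2 φ V)
    {X₀ θ : EuclideanSpace ℝ (Fin d)} (hu : ∀ X ∈ V, u X = φ X + ψ ‖X - X₀‖) (hθ : ‖θ‖ = 1)
    {S : Set ℝ} {C : ℝ} (hS : ∀ r ∈ S, 0 < r ∧ X₀ + r • θ ∈ V ∧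
      ‖fderiv ℝ (fderiv ℝ φ) (X₀ + r • θ)‖ ≤ C ∧ ‖gradient φ (X₀ + r • θ)‖ ≤ C ∧
      ‖gradient φ (X₀ + r • θ)‖ ^ 2 ≤ C * r) :
    IsRaySupersolution (fun x => u (X₀ + x • θ)) (fun x => f (X₀ + x • θ))
      (C ^ 3 + 2 * C ^ 2 + C) S := by
  intro r hr p m ht
  obtain ⟨hr0, hY, hB, hg, hg2⟩ := hS r hr
  have key := h.ray_test hVo hVU hφ hu hθ hr0 hY ht rfl
  have hsymm := (hφ.contDiffAt (hVo.mem_nhds hY)).isSymmSndFDerivAt (by simp)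
  set B := fderiv ℝ (fderiv ℝ φ) (X₀ + r • θ)
  set g := gradient φ (X₀ + r • θ)
  set q := inner ℝ g θ with hq
  have hqabs : |q| ≤ C := by
    calc |q| ≤ ‖g‖ * ‖θ‖ := abs_real_inner_le_norm g θ
      _ ≤ C := by rw [hθ, mul_one]; exact hg
  have hC : 0 ≤ C := (abs_nonneg _).trans hqabs
  set τ := g - q • θ with hτ
  have hP : g + (p - q) • θ = τ + p • θ := by rw [hτ]; module
  have hτ2 : ‖τ‖ ^ 2 = ‖g‖ ^ 2 - q ^ 2 := by
    rw [hτ, norm_sub_sq_real, real_inner_smul_right, norm_smul, mul_pow, hθ, Real.norm_eq_abs,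
      sq_abs, ← hq]
    ring
  have hτC : ‖τ‖ ≤ C := le_of_sq_le_sq (by nlinarith [sq_nonneg q, norm_nonneg g]) hC
  have hτ0 : 0 ≤ ‖g‖ ^ 2 - q ^ 2 := by rw [← hτ2]; positivity
  have e1 : |B τ θ| ≤ C * C := by
    calc |B τ θ| ≤ ‖B‖ * ‖τ‖ * ‖θ‖ := B.le_opNorm₂ τ θ
      _ ≤ C * C := by rw [hθ, mul_one]; gcongr
  have e2 : |B τ τ| ≤ C * C * C := by
    calc |B τ τ| ≤ ‖B‖ * ‖τ‖ * ‖τ‖ := B.le_opNorm₂ τ τ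
      _ ≤ C * C * C := by gcongr
  -- The term p² B(θ, θ) cancels against the one already in `key`, so the error is only linear in
  -- |p|.
  have e3 : B (τ + p • θ) (τ + p • θ) = B τ τ + 2 * (p * B τ θ) + p ^ 2 * B θ θ := by
    have hs : B θ τ = B τ θ := hsymm θ τ
    simp [hs]; ring
  have e4 : |p * B τ θ| ≤ |p| * (C * C) := by rw [abs_mul]; gcongr
  -- The 1/r from the curvature of spheres is compensated by the assumption ‖∇φ‖² ≤ C r.
  have e5 : |(p - q) * ((‖g‖ ^ 2 - q ^ 2) / r)| ≤ (|p| + C) * C := by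
    rw [abs_mul]
    have h1 : |p - q| ≤ |p| + C := (abs_sub _ _).trans (by linarith)
    have h2 : |(‖g‖ ^ 2 - q ^ 2) / r| ≤ C := by
      rw [abs_of_nonneg (by positivity), div_le_iff₀ hr0]
      nlinarith [sq_nonneg q]
    gcongr
  rw [hP, e3] at key
  have := (abs_le.1 e4).1
  have := (abs_le.1 e5).1
  have := (abs_le.1 e2).1
  have h6 : 0 ≤ |p| * C ^ 3 := by positivity
  show p ^ 2 * m ≤ f (X₀ + r • θ) + (C ^ 3 + 2 * C ^ 2 + C) * (1 + |p|)
  nlinarith [sq_nonneg C]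

/-! ### Almost everywhere statements in polar coordinates. -/

/-- A property that holds almost everywhere holds at almost every point of almost every ray. -/
lemma ae_sphere_ae_ray {E : Type*} [NormedAddCommGroup E] [NormedSpace ℝ E] [MeasurableSpace E]
    [BorelSpace E] [FiniteDimensional ℝ E] (μ : Measure E) [μ.IsAddHaarMeasure] {Q : E → Prop}
    (h : ∀ᵐ x ∂μ, Q x) (X₀ : E) :
    ∀ᵐ θ : Metric.sphere (0 : E) 1 ∂μ.toSphere, ∀ᵐ r : ℝ, 0 < r → Q (X₀ + r • (θ : E)) := by
  have h1 : ∀ᵐ z ∂μ, Q (X₀ + z) := (measurePreserving_add_left μ X₀).quasiMeasurePreserving.ae h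
  have h2 : ∀ᵐ z : ({0}ᶜ : Set E) ∂(μ.comap (↑)), Q (X₀ + z) :=
    (measurePreserving_subtype_coe
      (measurableSet_singleton (0 : E)).compl).quasiMeasurePreserving.ae (ae_restrict_of_ae h1)
  have h3 := (MeasurePreserving.symm (homeomorphUnitSphereProd E).toMeasurableEquiv
    μ.measurePreserving_homeomorphUnitSphereProd).quasiMeasurePreserving.ae h2
  filter_upwards [Measure.ae_ae_of_ae_prod h3] with θ hθ
  -- The radial density is a power of r, positive for r > 0, so its null sets are Lebesgue null.
  rw [Measure.volumeIoiPow, ae_withDensity_iff (by fun_prop)] at hθ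
  have h4 : ∀ᵐ r : Ioi (0 : ℝ) ∂(volume.comap (Subtype.val : Ioi (0 : ℝ) → ℝ)),
      Q (X₀ + (r : ℝ) • (θ : E)) := by
    filter_upwards [hθ] with r hr
    have := hr (by simpa using pow_pos r.2 _)
    simpa using this
  have h5 := (MeasurableEmbedding.subtype_coe (measurableSet_Ioi (a := (0 : ℝ)))).ae_map_iff
    (p := fun r : ℝ => Q (X₀ + r • (θ : E))) (μ := volume.comap Subtype.val) |>.2 h4
  rw [(MeasurableEmbedding.subtype_coe measurableSet_Ioi).map_comap, Subtype.range_coe] at h5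
  exact (ae_restrict_iff' measurableSet_Ioi).1 h5

/-- Directions along which an almost everywhere property holds are dense. -/
lemma exists_direction_ae_ray {E : Type*} [NormedAddCommGroup E] [NormedSpace ℝ E]
    [MeasurableSpace E] [BorelSpace E] [FiniteDimensional ℝ E] (μ : Measure E) [μ.IsAddHaarMeasure]
    {Q : E → Prop} (h : ∀ᵐ x ∂μ, Q x) (X₀ : E) {θ₀ : E} (hθ₀ : ‖θ₀‖ = 1) {O : Set E}
    (hO : O ∈ 𝓝 θ₀) : ∃ θ ∈ O, ‖θ‖ = 1 ∧ ∀ᵐ r : ℝ, 0 < r → Q (X₀ + r • θ) := by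
  have hd := Measure.dense_of_ae (ae_sphere_ae_ray μ h X₀)
  have hne : ((↑) ⁻¹' interior O : Set (Metric.sphere (0 : E) 1)).Nonempty :=
    ⟨⟨θ₀, by simpa using hθ₀⟩, mem_interior_iff_mem_nhds.2 hO⟩
  obtain ⟨θ, h1, h2⟩ := hd.inter_open_nonempty _
    (isOpen_interior.preimage continuous_subtype_val) hne
  exact ⟨θ, interior_subset h1, by simp, h2⟩

/-! ### Local and global Hölder continuity of gradients. -/

section Holder

variable {E F : Type*} [PseudoMetricSpace E] [PseudoMetricSpace F]

lemma holderOnWith_of_dist_le {g : E → F} {C : ℝ} {α : ℝ≥0} {s : Set E}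
    (h : ∀ x ∈ s, ∀ y ∈ s, dist (g x) (g y) ≤ C * dist x y ^ (α : ℝ)) :
    HolderOnWith C.toNNReal α g s := by
  intro x hx y hy
  rw [edist_dist, edist_dist, ENNReal.ofReal_rpow_of_nonneg dist_nonneg α.coe_nonneg]
  change _ ≤ ENNReal.ofReal C * _
  by_cases hC : 0 ≤ C
  · rw [← ENNReal.ofReal_mul hC]
    exact ENNReal.ofReal_le_ofReal (h x hx y hy)
  · have : dist (g x) (g y) ≤ 0 := (h x hx y hy).trans
      (mul_nonpos_of_nonpos_of_nonneg (le_of_not_ge hC) (by positivity))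
    rw [ENNReal.ofReal_of_nonpos this]
    exact zero_le

end Holder

/-- A locally Hölder continuous function is Hölder continuous on compact sets. -/
lemma IsCompact.exists_holderOnWith {E F : Type*} [MetricSpace E] [PseudoMetricSpace F] {g : E → F}
    {α : ℝ≥0} (hα : 0 < α) {K : Set E} (hK : IsCompact K)
    (h : ∀ x ∈ K, ∃ C : ℝ≥0, ∃ U ∈ 𝓝 x, HolderOnWith C α g U) :
    ∃ C : ℝ≥0, HolderOnWith C α g K := by
  suffices H : ∃ C : ℝ, ∀ z ∈ K ×ˢ K, dist (g z.1) (g z.2) ≤ C * dist z.1 z.2 ^ (α : ℝ) by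
    obtain ⟨C, hC⟩ := H
    exact ⟨_, holderOnWith_of_dist_le fun x hx y hy => hC (x, y) ⟨hx, hy⟩⟩
  -- Compactness is used for pairs: near the diagonal the local bound applies, and away from it the
  -- distance is bounded below while the values stay close.
  refine (hK.prod hK).induction_on
    (p := fun S => ∃ C : ℝ, ∀ z ∈ S, dist (g z.1) (g z.2) ≤ C * dist z.1 z.2 ^ (α : ℝ))
    ⟨0, by simp⟩ (fun s t hst ⟨C, hC⟩ => ⟨C, fun z hz => hC z (hst hz)⟩) ?_ ?_
  · rintro s t ⟨C, hC⟩ ⟨C', hC'⟩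
    refine ⟨max C C', fun z hz => ?_⟩
    have h0 : 0 ≤ dist z.1 z.2 ^ (α : ℝ) := by positivity
    rcases hz with hz | hz
    · exact (hC z hz).trans (mul_le_mul_of_nonneg_right (le_max_left _ _) h0)
    · exact (hC' z hz).trans (mul_le_mul_of_nonneg_right (le_max_right _ _) h0)
  · rintro ⟨x, y⟩ ⟨hx, hy⟩
    obtain ⟨C, U, hU, hCU⟩ := h x hx
    obtain ⟨C', U', hU', hCU'⟩ := h y hy
    rcases eq_or_ne x y with rfl | hxy
    · exact ⟨U ×ˢ U, mem_nhdsWithin_of_mem_nhds (prod_mem_nhds hU hU), C,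
        fun z hz => hCU.dist_le hz.1 hz.2⟩
    · have hg : ContinuousAt (fun z : E × E => dist (g z.1) (g z.2)) (x, y) :=
        Filter.Tendsto.dist
          (ContinuousAt.comp (f := Prod.fst) (x := (x, y))
            ((hCU.continuousOn hα).continuousAt hU) continuousAt_fst)
          (ContinuousAt.comp (f := Prod.snd) (x := (x, y))
            ((hCU'.continuousOn hα).continuousAt hU') continuousAt_snd)
      have hd : ContinuousAt (fun z : E × E => dist z.1 z.2) (x, y) := by fun_prop
      have hxy0 : 0 < dist x y := dist_pos.2 hxy
      set B := dist (g x) (g y) + 1 with hB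
      have hB0 : 0 < B := by positivity
      refine ⟨{z | dist (g z.1) (g z.2) < B ∧ dist x y / 2 < dist z.1 z.2},
        mem_nhdsWithin_of_mem_nhds ((hg.eventually (gt_mem_nhds (by simp [hB]))).and
          (hd.eventually (lt_mem_nhds (half_lt_self hxy0)))),
        B / (dist x y / 2) ^ (α : ℝ), fun z hz => hz.1.le.trans ?_⟩
      rw [div_mul_eq_mul_div, le_div_iff₀ (by positivity)]
      gcongr
      exact hz.2.le

/-- `u` is differentiable near `x`, and its gradient is Hölder continuous with exponent `α`
near `x`. -/
def IsC1HolderAt (α : ℝ≥0) (u : EuclideanSpace ℝ (Fin d) → ℝ) (x : EuclideanSpace ℝ (Fin d)) :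
    Prop :=
  ∃ C : ℝ≥0, ∃ U ∈ 𝓝 x, (∀ X ∈ U, DifferentiableAt ℝ u X) ∧ HolderOnWith C α (gradient u) U

lemma isC1HolderLoc_of_forall {α : ℝ≥0} (hα : 0 < α) {u : EuclideanSpace ℝ (Fin d) → ℝ}
    {U : Set (EuclideanSpace ℝ (Fin d))} (h : ∀ x ∈ U, IsC1HolderAt α u x) :
    IsC1HolderLoc α u U := by
  refine ⟨fun x hx => ContDiffAt.contDiffWithinAt ?_, fun K hK hKc =>
    hKc.exists_holderOnWith hα fun x hx => ?_⟩
  · obtain ⟨C, W, hW, hd, hC⟩ := h x hx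
    refine contDiffAt_one_iff.2 ⟨fderiv ℝ u, W, hW, ?_, fun X hX => (hd X hX).hasFDerivAt⟩
    rw [← toDual_comp_gradient]
    exact (InnerProductSpace.toDual ℝ _).continuous.comp_continuousOn (hC.continuousOn hα)
  · obtain ⟨C, W, hW, hd, hC⟩ := h x (hK hx)
    exact ⟨C, W, hW, hC⟩

lemma ContDiffAt.exists_holderOnWith_gradient {u : EuclideanSpace ℝ (Fin d) → ℝ}
    {x : EuclideanSpace ℝ (Fin d)} (h : ContDiffAt ℝ 2 u x) {α : ℝ≥0} (hα : α ≤ 1) :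
    ∃ C : ℝ≥0, ∃ U ∈ 𝓝 x, HolderOnWith C α (gradient u) U := by
  obtain ⟨L, W, hW, hL⟩ := (h.fderiv_right (m := 1) (by norm_num)).exists_lipschitzOnWith
  have hg : LipschitzOnWith L (gradient u) W := by
    intro X hX Y hY
    have := hL hX hY
    rwa [← toDual_gradient, ← toDual_gradient, LinearIsometryEquiv.edist_map] at this
  refine ⟨_, W ∩ Metric.ball x 1, inter_mem hW (Metric.ball_mem_nhds x one_pos),
    ((holderOnWith_one.2 hg).mono inter_subset_left).of_le (D := 2) (fun y hy z hz => ?_) hα⟩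
  rw [edist_dist]
  refine ENNReal.ofReal_le_of_le_toReal ?_
  have h1 := dist_triangle_right y z x
  have h2 := Metric.mem_ball.1 hy.2
  have h3 := Metric.mem_ball.1 hz.2
  norm_num
  linarith

lemma ContDiffAt.isC1HolderAt {u : EuclideanSpace ℝ (Fin d) → ℝ} {x : EuclideanSpace ℝ (Fin d)}
    (h : ContDiffAt ℝ 2 u x) {α : ℝ≥0} (hα : α ≤ 1) : IsC1HolderAt α u x := by
  obtain ⟨C, U, hU, hC⟩ := h.exists_holderOnWith_gradient hα
  have h2 : ∀ᶠ X in 𝓝 x, DifferentiableAt ℝ u X :=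
    (h.eventually (by simp)).mono fun X hX => hX.differentiableAt (by norm_num)
  exact ⟨C, U ∩ {X | DifferentiableAt ℝ u X}, inter_mem hU h2, fun X hX => hX.2,
    hC.mono inter_subset_left⟩

/-- The radial vector field with Hölder continuous radial part `D` is Hölder continuous. -/
lemma norm_radial_sub_le {E : Type*} [NormedAddCommGroup E] [NormedSpace ℝ E] {D : ℝ → ℝ}
    {K α : ℝ} (hK : 0 ≤ K) (hα : 0 < α) (hα1 : α ≤ 1) {a b : E}
    (hab : |D ‖a‖ - D ‖b‖| ≤ K * |‖a‖ - ‖b‖| ^ α) (ha : |D ‖a‖| ≤ K * ‖a‖ ^ α)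
    (hb : |D ‖b‖| ≤ K * ‖b‖ ^ α) :
    ‖(D ‖a‖ / ‖a‖) • a - (D ‖b‖ / ‖b‖) • b‖ ≤ 3 * K * ‖a - b‖ ^ α := by
  have hnorm {x : E} (hx : x ≠ 0) : ‖(D ‖x‖ / ‖x‖) • x‖ = |D ‖x‖| := by
    rw [norm_smul, norm_div, norm_norm, div_mul_cancel₀ _ (norm_ne_zero_iff.2 hx), Real.norm_eq_abs]
  have hp : 0 ≤ K * ‖a - b‖ ^ α := by positivity
  rcases eq_or_ne a 0 with rfl | ha0
  · rcases eq_or_ne b 0 with rfl | hb0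
    · simp [hα.ne']
    · rw [smul_zero, zero_sub, norm_neg, hnorm hb0]
      simp only [zero_sub, norm_neg] at hp ⊢
      linarith
  rcases eq_or_ne b 0 with rfl | hb0
  · rw [smul_zero, sub_zero, hnorm ha0]
    simp only [sub_zero] at hp ⊢
    linarith
  have ha1 : 0 < ‖a‖ := norm_pos_iff.2 ha0
  have hb1 : 0 < ‖b‖ := norm_pos_iff.2 hb0
  set x := ‖a - b‖ / ‖b‖ with hx
  have hx0 : 0 ≤ x := by positivity
  -- Unit vectors differ by at most min(2, 2x) ≤ 2x^α; the factor ‖b‖^α in the bound for D then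
  -- cancels the denominator of x^α.
  have hunit : ‖(‖a‖⁻¹ • a - ‖b‖⁻¹ • b)‖ ≤ 2 * x ^ α := by
    have h2 : ‖(‖a‖⁻¹ • a - ‖b‖⁻¹ • b)‖ ≤ 2 := by
      refine (norm_sub_le _ _).trans ?_
      rw [norm_smul, norm_smul, norm_inv, norm_inv, norm_norm, norm_norm,
        inv_mul_cancel₀ ha1.ne', inv_mul_cancel₀ hb1.ne']
      norm_num
    have h3 : ‖(‖a‖⁻¹ • a - ‖b‖⁻¹ • b)‖ ≤ 2 * x := by
      have e : ‖a‖⁻¹ • a - ‖b‖⁻¹ • b = ‖b‖⁻¹ • (a - b) + (‖a‖⁻¹ * ‖b‖⁻¹ * (‖b‖ - ‖a‖)) • a := by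
        rw [smul_sub, sub_add_eq_add_sub, ← add_smul]
        congr 2
        field_simp; ring
      rw [e]
      refine (norm_add_le _ _).trans ?_
      rw [norm_smul, norm_smul, norm_mul, norm_mul, norm_inv, norm_inv, norm_norm, norm_norm]
      have h4 : ‖‖b‖ - ‖a‖‖ ≤ ‖a - b‖ := by
        rw [norm_sub_rev]; exact abs_norm_sub_norm_le a b
      calc ‖b‖⁻¹ * ‖a - b‖ + ‖a‖⁻¹ * ‖b‖⁻¹ * ‖‖b‖ - ‖a‖‖ * ‖a‖
          = ‖b‖⁻¹ * ‖a - b‖ + ‖b‖⁻¹ * ‖‖b‖ - ‖a‖‖ := by field_simp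
        _ ≤ ‖b‖⁻¹ * ‖a - b‖ + ‖b‖⁻¹ * ‖a - b‖ := by gcongr
        _ = 2 * x := by rw [hx]; ring
    rcases le_total x 1 with h | h
    · refine h3.trans ?_
      have := Real.rpow_le_rpow_of_exponent_ge' hx0 h hα.le hα1
      rw [Real.rpow_one] at this
      linarith
    · have := Real.one_le_rpow h hα.le
      linarith
  have e : (D ‖a‖ / ‖a‖) • a - (D ‖b‖ / ‖b‖) • b =
      (D ‖a‖ - D ‖b‖) • (‖a‖⁻¹ • a) + D ‖b‖ • (‖a‖⁻¹ • a - ‖b‖⁻¹ • b) := by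
    simp only [div_eq_mul_inv, mul_smul]; module
  rw [e]
  refine (norm_add_le _ _).trans ?_
  rw [norm_smul, norm_smul (D ‖b‖), norm_smul, norm_inv, norm_norm, inv_mul_cancel₀ ha1.ne',
    mul_one, Real.norm_eq_abs, Real.norm_eq_abs]
  have h1 : |D ‖a‖ - D ‖b‖| ≤ K * ‖a - b‖ ^ α := hab.trans (by
    gcongr; exact abs_norm_sub_norm_le a b)
  have h2 : |D ‖b‖| * ‖(‖a‖⁻¹ • a - ‖b‖⁻¹ • b)‖ ≤ (K * ‖b‖ ^ α) * (2 * x ^ α) := by gcongr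
  have h3 : (K * ‖b‖ ^ α) * (2 * x ^ α) = 2 * (K * ‖a - b‖ ^ α) := by
    rw [hx, Real.div_rpow (norm_nonneg _) (norm_nonneg _)]
    field_simp
  linarith

/-! ### Regularity of the radial part and of u at each point of V. -/

lemma abs_le_rpow_of_cube_le {A K x : ℝ} (hK : 0 ≤ K) (h : |A| ^ 3 ≤ K * |x|) :
    |A| ≤ K ^ (1 / 3 : ℝ) * |x| ^ (1 / 3 : ℝ) := by
  rw [← Real.mul_rpow hK (abs_nonneg x)]
  refine le_trans (le_of_eq ?_) (Real.rpow_le_rpow (by positivity) h (by norm_num))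
  rw [← Real.rpow_natCast, ← Real.rpow_mul (abs_nonneg A)]
  norm_num

/-- The radial part is differentiable, with Hölder continuous derivative, on an interval of radii
along which `φ` is controlled on a good ray. -/
lemma exists_radial_derivative {u f φ : EuclideanSpace ℝ (Fin d) → ℝ}
    {ψ : ℝ → ℝ} {U V : Set (EuclideanSpace ℝ (Fin d))} (h : IsViscositySolution u f U)
    (hVo : IsOpen V) (hVU : V ⊆ U) (hφ : ContDiffOn ℝ 2 φ V)
    {X₀ θ : EuclideanSpace ℝ (Fin d)} (hu : ∀ X ∈ V, u X = φ X + ψ ‖X - X₀‖) (hθ : ‖θ‖ = 1)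
    {M : ℝ} (hM : ∀ᵐ r : ℝ, 0 < r → X₀ + r • θ ∈ U → |f (X₀ + r • θ)| ≤ M)
    {a b : ℝ} (ha : 0 ≤ a) (hab : a < b) (hab1 : b ≤ a + 1)
    {W : Set (EuclideanSpace ℝ (Fin d))} (hWV : W ⊆ V) (hW : ∀ r ∈ Icc a b, X₀ + r • θ ∈ W)
    {C : ℝ} (hB : ∀ X ∈ W, ‖fderiv ℝ (fderiv ℝ φ) X‖ ≤ C) (hg : ∀ X ∈ W, ‖gradient φ X‖ ≤ C)
    (hg2 : ∀ r ∈ Ioo a b, ‖gradient φ (X₀ + r • θ)‖ ^ 2 ≤ C * r)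
    {L : ℝ≥0} (hL : LipschitzOnWith L (fderiv ℝ φ) W) :
    ∃ (D : ℝ → ℝ) (K : ℝ), 0 ≤ K ∧
      (∀ x ∈ Icc a ((a + b) / 2), HasDerivWithinAt ψ (D x) (Icc a ((a + b) / 2)) x) ∧
      ∀ x ∈ Icc a ((a + b) / 2), ∀ y ∈ Icc a ((a + b) / 2),
        |D x - D y| ≤ K * |x - y| ^ (1 / 3 : ℝ) := by
  obtain ⟨hc, hsup, hsub⟩ := h
  have hmem : ∀ r ∈ Icc a b, X₀ + r • θ ∈ V := fun r hr => hWV (hW r hr)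
  have hI {r : ℝ} (hr : r ∈ Ioo a b) := Ioo_subset_Icc_self hr
  have hC : 0 ≤ C := (norm_nonneg _).trans (hg _ (hW a ⟨le_rfl, hab.le⟩))
  have h1 := hsup.isRaySupersolution hVo hVU hφ hu hθ (S := Ioo a b) (C := C) fun r hr =>
    ⟨ha.trans_lt hr.1, hmem r (hI hr), hB _ (hW r (hI hr)), hg _ (hW r (hI hr)), hg2 r hr⟩
  have h2 := hsub.neg.isRaySupersolution (φ := -φ) (ψ := -ψ) hVo hVU hφ.neg
    (fun X hX => by simp only [Pi.neg_apply]; rw [hu X hX]; ring) hθ (S := Ioo a b) (C := C)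
    fun r hr => by
      rw [gradient_neg_eq, fderiv_neg_eq, fderiv_neg, norm_neg]
      exact ⟨ha.trans_lt hr.1, hmem r (hI hr),
        (norm_neg (fderiv ℝ (fderiv ℝ φ) _)).trans_le (hB _ (hW r (hI hr))), hg _ (hW r (hI hr)),
        hg2 r hr⟩
  have hcw : ContinuousOn (fun x : ℝ => u (X₀ + x • θ)) (Icc a b) :=
    hc.comp (Continuous.continuousOn (by fun_prop)) fun r hr => hVU (hmem r hr)
  have hFM (r : ℝ) (hr : 0 < r → X₀ + r • θ ∈ U → |f (X₀ + r • θ)| ≤ M) (hrI : r ∈ Ioo a b) :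
      |f (X₀ + r • θ)| ≤ M := hr (ha.trans_lt hrI.1) (hVU (hmem r (hI hrI)))
  obtain ⟨D, K, hD, hK⟩ := IsRaySupersolution.exists_deriv (M := M) hab (by positivity) h1
    (hM.mono fun r hr hrI => (abs_le.1 (hFM r hr hrI)).2) h2
    (hM.mono fun r hr hrI => by
      have := (abs_le.1 (hFM r hr hrI)).1
      simp only [Pi.neg_apply]
      linarith) hcw
  set c := (a + b) / 2 with hcdef
  have hcb : c ≤ b := by rw [hcdef]; linarith
  have hac : a < c := by rw [hcdef]; linarith
  have hcI {x : ℝ} (hx : x ∈ Icc a c) : x ∈ Icc a b := ⟨hx.1, hx.2.trans hcb⟩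
  have hK0 : 0 ≤ K := by
    have := (pow_nonneg (abs_nonneg _) 3).trans (hK a ⟨le_rfl, hac.le⟩ c ⟨hac.le, le_rfl⟩)
    exact nonneg_of_mul_nonneg_left this (abs_pos.2 (sub_ne_zero.2 hac.ne))
  refine ⟨fun x => D x - fderiv ℝ φ (X₀ + x • θ) θ, K ^ (1 / 3 : ℝ) + L, by positivity,
    fun x hx => ?_, fun x hx y hy => ?_⟩
  · have e1 := (hasDerivAt_comp_line (T := φ) (Y := X₀) (Z := θ) (t := x)
      ((hφ.contDiffAt (hVo.mem_nhds (hmem x (hcI hx)))).differentiableAt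
        (by norm_num))).hasDerivWithinAt (s := Icc a c)
    refine ((hD x hx).sub e1).congr_of_mem (fun y hy => ?_) hx
    have e2 := hu _ (hmem y (hcI hy))
    have e3 : ‖X₀ + y • θ - X₀‖ = y := by
      simp [norm_smul, hθ, abs_of_nonneg (ha.trans hy.1)]
    rw [e3] at e2
    simp only [Pi.sub_apply]
    linarith
  · have e1 := abs_le_rpow_of_cube_le hK0 (hK x hx y hy)
    have e2 : |fderiv ℝ φ (X₀ + x • θ) θ - fderiv ℝ φ (X₀ + y • θ) θ| ≤
        L * |x - y| ^ (1 / 3 : ℝ) := by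
      have e3 := hL.dist_le_mul _ (hW x (hcI hx)) _ (hW y (hcI hy))
      rw [dist_eq_norm, dist_eq_norm, show X₀ + x • θ - (X₀ + y • θ) = (x - y) • θ by module,
        norm_smul, hθ, mul_one, Real.norm_eq_abs] at e3
      -- Here the interval length at most 1 turns the Lipschitz bound for ∇φ into a 1/3-Hölder
      -- bound.
      have e4 : |x - y| ≤ |x - y| ^ (1 / 3 : ℝ) := by
        have h1 : |x - y| ≤ 1 := by
          have := hx.1; have := hx.2; have := hy.1; have := hy.2
          rw [abs_le]; constructor <;> linarith
        have := Real.rpow_le_rpow_of_exponent_ge' (abs_nonneg (x - y)) h1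
          (by norm_num : (0 : ℝ) ≤ 1 / 3) (by norm_num : (1 / 3 : ℝ) ≤ 1)
        rwa [Real.rpow_one] at this
      calc _ = |(fderiv ℝ φ (X₀ + x • θ) - fderiv ℝ φ (X₀ + y • θ)) θ| := by simp
        _ ≤ ‖fderiv ℝ φ (X₀ + x • θ) - fderiv ℝ φ (X₀ + y • θ)‖ * ‖θ‖ :=
          (fderiv ℝ φ (X₀ + x • θ) - fderiv ℝ φ (X₀ + y • θ)).le_opNorm θ
        _ ≤ L * |x - y| := by rw [hθ, mul_one]; exact e3
        _ ≤ _ := by gcongr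
    calc _ = |(D x - D y) - (fderiv ℝ φ (X₀ + x • θ) θ - fderiv ℝ φ (X₀ + y • θ) θ)| := by ring_nf
      _ ≤ _ := abs_sub _ _
      _ ≤ _ := by rw [add_mul]; exact add_le_add e1 e2

/-- A viscosity supersolution has no convex conical singularity. -/
lemma IsViscositySupersolution.radial_slope_nonpos {u f φ : EuclideanSpace ℝ (Fin d) → ℝ}
    {ψ : ℝ → ℝ} {U V : Set (EuclideanSpace ℝ (Fin d))} (h : IsViscositySupersolution u f U)
    (hVo : IsOpen V) (hVU : V ⊆ U) {X₀ θ : EuclideanSpace ℝ (Fin d)} (hX₀ : X₀ ∈ V)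
    (hφ : φ =O[𝓝 X₀] (fun X => ‖X - X₀‖ ^ 2))
    (hu : ∀ X ∈ V, u X = φ X + ψ ‖X - X₀‖) (hθ : ‖θ‖ = 1) {s c : ℝ} (hc : 0 < c)
    (hψ : HasDerivWithinAt ψ s (Icc 0 c) 0) : s ≤ 0 := by
  by_contra! hs
  obtain ⟨C, hC⟩ := hφ.bound
  have hφ0 : φ X₀ = 0 := by simpa using hC.self_of_nhds
  have hcont : Tendsto (fun X => ‖X - X₀‖) (𝓝 X₀) (𝓝[Icc 0 c] 0) := by
    have h0 : Tendsto (fun X => ‖X - X₀‖) (𝓝 X₀) (𝓝 0) := by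
      have : Continuous fun X => ‖X - X₀‖ := by fun_prop
      simpa using this.tendsto X₀
    refine tendsto_nhdsWithin_iff.2 ⟨h0, ?_⟩
    filter_upwards [h0.eventually (gt_mem_nhds hc)] with X hX using ⟨norm_nonneg _, hX.le⟩
  have hψ' : ∀ᶠ X in 𝓝 X₀, s / 2 * ‖X - X₀‖ ≤ ψ ‖X - X₀‖ - ψ 0 := by
    have := hcont.eventually (hψ.isLittleO.def (half_pos hs))
    filter_upwards [this] with X hX
    simp only [sub_zero, smul_eq_mul, Real.norm_eq_abs, abs_norm] at hX
    have := (abs_le.1 hX).1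
    linarith
  -- If s > 0, the paraboloid with gradient (s/4)θ and Hessian k·Id lies below u near X₀: slope s/2
  -- leaves a further s/4 to absorb the quadratic terms. So k(s/4)² ≤ f(X₀) for every k, which is
  -- absurd.
  have key : ∀ k : ℕ, k * (s / 4) ^ 2 ≤ f X₀ := by
    intro k
    obtain ⟨I, hI⟩ : ∃ I : EuclideanSpace ℝ (Fin d) →L[ℝ] EuclideanSpace ℝ (Fin d) →L[ℝ] ℝ,
      ∀ v w, I v w = inner ℝ v w := ⟨innerSL ℝ, fun _ _ => rfl⟩
    have := h.quadratic_test (hVU hX₀) (InnerProductSpace.toDual ℝ _ ((s / 4) • θ))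
      ((k : ℝ) • I) (fun v w => by simp [hI, real_inner_comm]) (fun ε hε => by
        have hsmall : ∀ᶠ X in 𝓝 X₀, (k / 2 + C) * ‖X - X₀‖ ≤ s / 4 := by
          have : Continuous fun X => (k / 2 + C) * ‖X - X₀‖ := by fun_prop
          have := this.tendsto X₀
          simp only [sub_self, norm_zero, mul_zero] at this
          filter_upwards [this.eventually (gt_mem_nhds (by linarith : 0 < s / 4))] with X hX
            using hX.le
        filter_upwards [hVo.mem_nhds hX₀, hC, hψ', hsmall] with X hX h1 h2 h3
        rw [hu X hX, hu X₀ hX₀, hφ0, sub_self, norm_zero]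
        simp only [smul_apply, hI, real_inner_self_eq_norm_sq,
          InnerProductSpace.toDual_apply_apply, real_inner_smul_left, smul_eq_mul]
        rw [norm_pow, norm_norm, Real.norm_eq_abs] at h1
        have h4 := (abs_le.1 h1).1
        have h5 : inner ℝ θ (X - X₀) ≤ ‖X - X₀‖ := by
          have := real_inner_le_norm θ (X - X₀)
          rwa [hθ, one_mul] at this
        have h6 := mul_le_mul_of_nonneg_right h3 (norm_nonneg (X - X₀))
        have h7 := mul_le_mul_of_nonneg_left h5 (by linarith : 0 ≤ s / 4)
        have h8 : 0 ≤ ε * ‖X - X₀‖ ^ 2 := by positivity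
        nlinarith)
    simp only [LinearIsometryEquiv.symm_apply_apply, smul_apply, hI,
      real_inner_self_eq_norm_sq, norm_smul, hθ, smul_eq_mul, mul_one, Real.norm_eq_abs,
      sq_abs] at this
    exact this
  obtain ⟨k, hk⟩ := exists_nat_gt (f X₀ / (s / 4) ^ 2)
  rw [div_lt_iff₀ (by positivity)] at hk
  exact absurd (key k) (not_le.2 hk)

/-- Regularity of `φ + ψ(|· - X₀|)` at a point from the regularity of `ψ`. -/
lemma isC1HolderAt_of_radial {u φ : EuclideanSpace ℝ (Fin d) → ℝ} {ψ : ℝ → ℝ}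
    {V : Set (EuclideanSpace ℝ (Fin d))} (hVo : IsOpen V) (hφ : ContDiffOn ℝ 2 φ V)
    {X₀ Y : EuclideanSpace ℝ (Fin d)} (hY : Y ∈ V) (hu : ∀ X ∈ V, u X = φ X + ψ ‖X - X₀‖)
    {D : ℝ → ℝ} {K a c : ℝ} (hK : 0 ≤ K) (ha : 0 ≤ a) (hac : a < c)
    (hD : ∀ x ∈ Icc a c, HasDerivWithinAt ψ (D x) (Icc a c) x)
    (hDK : ∀ x ∈ Icc a c, ∀ y ∈ Icc a c, |D x - D y| ≤ K * |x - y| ^ (1 / 3 : ℝ))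
    (hD0 : a = 0 → D 0 = 0) (haY : a = 0 ∨ a < ‖Y - X₀‖) (hYc : ‖Y - X₀‖ < c) :
    IsC1HolderAt (1 / 3) u Y := by
  -- The radial field also needs |D x| ≤ K' x^(1/3). For a = 0 this is the Hölder bound with D 0 =
  -- 0; for a > 0 the radii stay away from 0 and enlarging the constant suffices.
  obtain ⟨K', hK', hDK', hD'⟩ : ∃ K', 0 ≤ K' ∧
      (∀ x ∈ Icc a c, ∀ y ∈ Icc a c, |D x - D y| ≤ K' * |x - y| ^ (1 / 3 : ℝ)) ∧
      ∀ x ∈ Icc a c, |D x| ≤ K' * x ^ (1 / 3 : ℝ) := by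
    rcases ha.eq_or_lt with rfl | ha0
    · refine ⟨K, hK, hDK, fun x hx => ?_⟩
      have := hDK x hx 0 ⟨le_rfl, hac.le⟩
      rwa [hD0 rfl, sub_zero, sub_zero, abs_of_nonneg hx.1] at this
    · set B := |D a| + K * (c - a) ^ (1 / 3 : ℝ) with hB
      have hca : 0 < c - a := sub_pos.2 hac
      have ha3 : 0 < a ^ (1 / 3 : ℝ) := by positivity
      refine ⟨K + B / a ^ (1 / 3 : ℝ), by positivity, fun x hx y hy => (hDK x hx y hy).trans ?_,
        fun x hx => ?_⟩
      · gcongr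
        exact le_add_of_nonneg_right (by positivity)
      · have e1 := hDK x hx a ⟨le_rfl, hac.le⟩
        have e2 : |x - a| ^ (1 / 3 : ℝ) ≤ (c - a) ^ (1 / 3 : ℝ) := by
          rw [abs_of_nonneg (sub_nonneg.2 hx.1)]
          exact Real.rpow_le_rpow (sub_nonneg.2 hx.1) (by linarith [hx.2]) (by norm_num)
        have e3 : |D x| ≤ B := by
          have := abs_sub_abs_le_abs_sub (D x) (D a)
          have := mul_le_mul_of_nonneg_left e2 hK
          rw [hB]; linarith
        have e4 : a ^ (1 / 3 : ℝ) ≤ x ^ (1 / 3 : ℝ) := Real.rpow_le_rpow ha hx.1 (by norm_num)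
        calc |D x| ≤ B / a ^ (1 / 3 : ℝ) * a ^ (1 / 3 : ℝ) := by
              rw [div_mul_cancel₀ _ ha3.ne']; exact e3
          _ ≤ (K + B / a ^ (1 / 3 : ℝ)) * x ^ (1 / 3 : ℝ) := by
              gcongr
              exact le_add_of_nonneg_left hK
  have hcont : Continuous fun X : EuclideanSpace ℝ (Fin d) => ‖X - X₀‖ := by fun_prop
  have hr : ∀ᶠ X in 𝓝 Y, (a = 0 ∨ a < ‖X - X₀‖) ∧ ‖X - X₀‖ < c := by
    refine Eventually.and ?_ ((hcont.tendsto Y).eventually (gt_mem_nhds hYc))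
    rcases haY with h | h
    · exact Eventually.of_forall fun _ => Or.inl h
    · exact ((hcont.tendsto Y).eventually (lt_mem_nhds h)).mono fun _ => Or.inr
  have hgrad : ∀ᶠ X in 𝓝 Y,
      HasGradientAt u (gradient φ X + (D ‖X - X₀‖ / ‖X - X₀‖) • (X - X₀)) X := by
    filter_upwards [hr, hVo.mem_nhds hY] with X hX hXV
    have hφd : HasGradientAt φ (gradient φ X) X :=
      ((hφ.contDiffAt (hVo.mem_nhds hXV)).differentiableAt (by norm_num)).hasGradientAt
    suffices H : HasGradientAt (fun X => ψ ‖X - X₀‖) ((D ‖X - X₀‖ / ‖X - X₀‖) • (X - X₀)) X by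
      refine HasGradientAt.congr_of_eventuallyEq (f := fun X => φ X + ψ ‖X - X₀‖) ?_ ?_
      · rw [hasGradientAt_iff_hasFDerivAt] at hφd H ⊢
        rw [map_add]
        exact hφd.add H
      · filter_upwards [hVo.mem_nhds hXV] with Z hZ using hu Z hZ
    rcases eq_or_ne X X₀ with rfl | hne
    · have ha0 : a = 0 := by
        rcases hX.1 with h | h
        · exact h
        · simp at h; linarith
      subst ha0
      have hψ := hD 0 ⟨le_rfl, hac.le⟩
      rw [hD0 rfl] at hψ
      rw [sub_self, smul_zero, hasGradientAt_iff_isLittleO]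
      have hto : Tendsto (fun Z => ‖Z - X‖) (𝓝 X) (𝓝[Icc 0 c] 0) := by
        have h0 := hcont.tendsto X
        rw [sub_self, norm_zero] at h0
        refine tendsto_nhdsWithin_iff.2 ⟨h0, ?_⟩
        filter_upwards [h0.eventually (gt_mem_nhds hac)] with Z hZ using ⟨norm_nonneg _, hZ.le⟩
      have h1 := hψ.isLittleO.comp_tendsto hto
      refine (Asymptotics.isLittleO_norm_right.1 (h1.congr (fun Z => ?_) fun Z => ?_))
      · simp
      · simp
    · have hpos : 0 < ‖X - X₀‖ := norm_pos_iff.2 (sub_ne_zero.2 hne)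
      have hIoo : ‖X - X₀‖ ∈ Ioo a c := by
        refine ⟨?_, hX.2⟩
        rcases hX.1 with h | h
        · rwa [h]
        · exact h
      have hψ := (hD _ (Ioo_subset_Icc_self hIoo)).hasDerivAt (Icc_mem_nhds hIoo.1 hIoo.2)
      have hn : HasFDerivAt (fun X : EuclideanSpace ℝ (Fin d) => ‖X - X₀‖)
          (‖X - X₀‖⁻¹ • innerSL ℝ (X - X₀)) X := by
        have h1 := (((hasFDerivAt_id X).sub_const X₀).norm_sq).sqrt (by
          simp only [id]; positivity)
        simp only [id, Real.sqrt_sq (norm_nonneg _)] at h1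
        refine h1.congr_fderiv ?_
        ext v
        simp
        field_simp
      rw [hasGradientAt_iff_hasFDerivAt]
      refine (hψ.comp_hasFDerivAt X hn).congr_fderiv ?_
      ext v
      simp
      ring
  obtain ⟨C, W, hW, hC⟩ := (hφ.contDiffAt (hVo.mem_nhds hY)).exists_holderOnWith_gradient
    (α := 1 / 3) (by norm_num [← NNReal.coe_le_coe])
  refine ⟨_, W ∩ {X | ((a = 0 ∨ a < ‖X - X₀‖) ∧ ‖X - X₀‖ < c) ∧
    HasGradientAt u (gradient φ X + (D ‖X - X₀‖ / ‖X - X₀‖) • (X - X₀)) X},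
    inter_mem hW (hr.and hgrad), fun X hX => hX.2.2.differentiableAt,
    holderOnWith_of_dist_le (C := C + 3 * K') fun X hX Z hZ => ?_⟩
  have hI {X : EuclideanSpace ℝ (Fin d)} (h : (a = 0 ∨ a < ‖X - X₀‖) ∧ ‖X - X₀‖ < c) :
      ‖X - X₀‖ ∈ Icc a c := by
    refine ⟨?_, h.2.le⟩
    rcases h.1 with h | h
    · rw [h]; exact norm_nonneg _
    · exact h.le
  rw [hX.2.2.gradient, hZ.2.2.gradient]
  have e1 := hC.dist_le hX.1 hZ.1
  have e2 := norm_radial_sub_le (a := X - X₀) (b := Z - X₀) (D := D) hK'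
    (by norm_num : (0 : ℝ) < 1 / 3) (by norm_num) (hDK' _ (hI hX.2.1) _ (hI hZ.2.1))
    (hD' _ (hI hX.2.1)) (hD' _ (hI hZ.2.1))
  rw [sub_sub_sub_cancel_right, ← dist_eq_norm X Z,
    ← dist_eq_norm ((D ‖X - X₀‖ / ‖X - X₀‖) • (X - X₀))] at e2
  have e3 : (((1 / 3 : ℝ≥0) : ℝ≥0) : ℝ) = 1 / 3 := by simp
  rw [e3] at e1 ⊢
  calc _ ≤ _ := dist_add_add_le _ _ _ _
    _ ≤ _ := add_le_add e1 e2
    _ = _ := by ring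

lemma MeasureTheory.MemLp.exists_ae_abs_le {E : Type*} [MeasurableSpace E] {μ : Measure E}
    {f : E → ℝ} {s : Set E} (hs : MeasurableSet s) (hf : MemLp f ⊤ (μ.restrict s)) :
    ∃ M, ∀ᵐ x ∂μ, x ∈ s → |f x| ≤ M := by
  have h := hf.2
  rw [eLpNorm_exponent_top] at h
  refine ⟨(eLpNormEssSup f (μ.restrict s)).toReal, (ae_restrict_iff' hs).1 ?_⟩
  filter_upwards [ae_le_eLpNormEssSup (f := f) (μ := μ.restrict s)] with x hx
  have := ENNReal.toReal_mono h.ne hx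
  simpa using this

lemma norm_gradient_eq (φ : EuclideanSpace ℝ (Fin d) → ℝ) (X : EuclideanSpace ℝ (Fin d)) :
    ‖gradient φ X‖ = ‖fderiv ℝ φ X‖ := by
  rw [← toDual_gradient, LinearIsometryEquiv.norm_map]

lemma ContDiffAt.exists_nhds_bounds {φ : EuclideanSpace ℝ (Fin d) → ℝ}
    {Y : EuclideanSpace ℝ (Fin d)} (hφ : ContDiffAt ℝ 2 φ Y) :
    ∃ W ∈ 𝓝 Y, ∃ (C : ℝ) (L : ℝ≥0), 0 ≤ C ∧ (∀ X ∈ W, ‖fderiv ℝ (fderiv ℝ φ) X‖ ≤ C) ∧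
      (∀ X ∈ W, ‖gradient φ X‖ ≤ C) ∧ LipschitzOnWith L (fderiv ℝ φ) W := by
  have h1 : ContDiffAt ℝ 1 (fderiv ℝ φ) Y := hφ.fderiv_right (by norm_num)
  have h2 : ContDiffAt ℝ 0 (fderiv ℝ (fderiv ℝ φ)) Y := h1.fderiv_right (by norm_num)
  obtain ⟨L, W, hW, hL⟩ := h1.exists_lipschitzOnWith
  have e1 := h1.continuousAt.norm.eventually (gt_mem_nhds (lt_add_one _))
  have e2 := ((continuous_norm (E := EuclideanSpace ℝ (Fin d) →L[ℝ]
    EuclideanSpace ℝ (Fin d) →L[ℝ] ℝ)).continuousAt.comp h2.continuousAt).eventually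
      (gt_mem_nhds (lt_add_one _))
  refine ⟨_, inter_mem hW (e1.and e2),
    max (‖fderiv ℝ φ Y‖ + 1) (‖fderiv ℝ (fderiv ℝ φ) Y‖ + 1), L, by positivity,
    fun X hX => hX.2.2.le.trans (le_max_right _ _), fun X hX => ?_, hL.mono inter_subset_left⟩
  rw [norm_gradient_eq]
  exact hX.2.1.le.trans (le_max_left _ _)

lemma fderiv_eq_zero_of_isBigO_sq {φ : EuclideanSpace ℝ (Fin d) → ℝ}
    {X₀ : EuclideanSpace ℝ (Fin d)} (hφ : φ =O[𝓝 X₀] (fun X => ‖X - X₀‖ ^ 2)) :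
    fderiv ℝ φ X₀ = 0 := by
  obtain ⟨C, hC⟩ := hφ.bound
  have hφ0 : φ X₀ = 0 := by simpa using hC.self_of_nhds
  refine HasFDerivAt.fderiv (.of_isLittleO ?_)
  simp only [hφ0, sub_zero, zero_apply]
  exact hφ.trans_isLittleO (Asymptotics.isLittleO_pow_sub_sub X₀ one_lt_two)

/-- A good ray need not pass through Y: it only has to stay where φ is controlled, since the
regularity of ψ at radii near ‖Y − X₀‖ is all that is used. At Y = X₀ the super- and subsolution
properties together force ψ'(0) = 0. -/
lemma IsViscositySolution.isC1HolderAt {u f : EuclideanSpace ℝ (Fin d) → ℝ} (hd : 1 ≤ d)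
    {U V : Set (EuclideanSpace ℝ (Fin d))} (h : IsViscositySolution u f U) {M : ℝ}
    (hM : ∀ᵐ x, x ∈ U → |f x| ≤ M) {X₀ : EuclideanSpace ℝ (Fin d)} (hVo : IsOpen V)
    (hX₀ : X₀ ∈ V) (hVU : V ⊆ U) (hrad : SmoothUpToRadialSingularityOn u X₀ V)
    {Y : EuclideanSpace ℝ (Fin d)} (hY : Y ∈ V) : IsC1HolderAt (1 / 3) u Y := by
  obtain ⟨φ, ψ, hφ, hφO, hu⟩ := hrad
  obtain ⟨W, hW, C, L, hC, hB, hg, hL⟩ :=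
    (hφ.contDiffAt (hVo.mem_nhds hY)).exists_nhds_bounds
  have hWV : W ∩ V ∈ 𝓝 Y := inter_mem hW (hVo.mem_nhds hY)
  have bounds {C' : ℝ} (hC' : C ≤ C') :
      (∀ X ∈ W ∩ V, ‖fderiv ℝ (fderiv ℝ φ) X‖ ≤ C') ∧ (∀ X ∈ W ∩ V, ‖gradient φ X‖ ≤ C') :=
    ⟨fun X hX => (hB X hX.1).trans hC', fun X hX => (hg X hX.1).trans hC'⟩
  rcases eq_or_ne Y X₀ with rfl | hne
  · obtain ⟨ε, hε, hball⟩ := Metric.mem_nhds_iff.1 hWV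
    obtain ⟨θ, -, hθ, hMθ⟩ := exists_direction_ae_ray volume hM Y
      (θ₀ := EuclideanSpace.single (⟨0, hd⟩ : Fin d) (1 : ℝ)) (by simp) univ_mem
    set b := min (ε / 2) 1 with hb
    have hb0 : 0 < b := by positivity
    have hbε : b < ε := (min_le_left _ _).trans_lt (by linarith)
    have hray : ∀ r ∈ Icc 0 b, Y + r • θ ∈ W ∩ V := fun r hr => hball (by
      simp [norm_smul, hθ, abs_of_nonneg hr.1]
      linarith [hr.2])
    have hD0 := fderiv_eq_zero_of_isBigO_sq hφO
    -- Since φ = O(‖X − X₀‖²), ∇φ vanishes at X₀, so ‖∇φ‖ ≤ L r along the ray; one factor r is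
    -- enough.
    have hgr : ∀ r ∈ Ioo 0 b, ‖gradient φ (Y + r • θ)‖ ^ 2 ≤ (C + C * L) * r := by
      intro r hr
      have hm := (hray r (Ioo_subset_Icc_self hr)).1
      have e1 := hL.dist_le_mul _ hm _ (mem_of_mem_nhds hW)
      rw [hD0, dist_zero_right, ← norm_gradient_eq, dist_eq_norm, add_sub_cancel_left, norm_smul,
        hθ, mul_one, Real.norm_of_nonneg hr.1.le] at e1
      have e2 := mul_le_mul (hg _ hm) e1 (norm_nonneg _) hC
      nlinarith [mul_nonneg hC hr.1.le]
    have hCL : C ≤ C + C * L := le_add_of_nonneg_right (by positivity)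
    obtain ⟨D, K, hK, hD, hDK⟩ := exists_radial_derivative h hVo hVU hφ hu hθ hMθ le_rfl hb0
      (by rw [zero_add]; exact min_le_right _ _) inter_subset_right hray (bounds hCL).1
      (bounds hCL).2 hgr (hL.mono inter_subset_left)
    have hc : 0 < (0 + b) / 2 := by linarith
    have hψ0 := hD 0 ⟨le_rfl, hc.le⟩
    have hle := h.2.1.radial_slope_nonpos hVo hVU hX₀ hφO hu hθ hc hψ0
    have hge := h.2.2.neg.radial_slope_nonpos (φ := -φ) (ψ := -ψ) hVo hVU hX₀ hφO.neg_left
      (fun X hX => by simp only [Pi.neg_apply]; rw [hu X hX]; ring) hθ hc hψ0.neg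
    exact isC1HolderAt_of_radial hVo hφ hY hu hK le_rfl hc hD hDK
      (fun _ => le_antisymm hle (by linarith)) (Or.inl rfl) (by simpa using hb0)
  · set r₀ := ‖Y - X₀‖ with hr₀
    have hr₀0 : 0 < r₀ := norm_pos_iff.2 (sub_ne_zero.2 hne)
    set θ₀ := r₀⁻¹ • (Y - X₀) with hθ₀
    have hθ₀1 : ‖θ₀‖ = 1 := by
      rw [hθ₀, norm_smul, norm_inv, norm_norm, inv_mul_cancel₀ hr₀0.ne']
    have hYθ : X₀ + r₀ • θ₀ = Y := by
      rw [hθ₀, smul_smul, mul_inv_cancel₀ hr₀0.ne', one_smul, add_sub_cancel]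
    have hcont : Continuous fun z : ℝ × EuclideanSpace ℝ (Fin d) => X₀ + z.1 • z.2 := by fun_prop
    have hpre := (hcont.tendsto (r₀, θ₀)).eventually_mem (by rw [hYθ]; exact hWV)
    obtain ⟨I, hI, O, hO, hsub⟩ := mem_nhds_prod_iff.1 hpre
    obtain ⟨ε, hε, hball⟩ := Metric.mem_nhds_iff.1 hI
    obtain ⟨θ, hθO, hθ, hMθ⟩ := exists_direction_ae_ray volume hM X₀ hθ₀1 hO
    set δ := min (min (ε / 4) (r₀ / 2)) (1 / 4) with hδ
    have hδ0 : 0 < δ := by positivity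
    have hδε : δ ≤ ε / 4 := (min_le_left _ _).trans (min_le_left _ _)
    have hδr : δ ≤ r₀ / 2 := (min_le_left _ _).trans (min_le_right _ _)
    have hδ1 : δ ≤ 1 / 4 := min_le_right _ _
    have ha : 0 < r₀ - δ := by linarith
    -- The interval is lopsided because regularity is obtained only on its left half, which is [r₀ −
    -- δ, r₀ + δ] and has r₀ in its interior.
    have hray : ∀ r ∈ Icc (r₀ - δ) (r₀ + 3 * δ), X₀ + r • θ ∈ W ∩ V := fun r hr =>
      hsub (mk_mem_prod (hball (by
        rw [Metric.mem_ball, Real.dist_eq, abs_lt]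
        constructor <;> linarith [hr.1, hr.2])) hθO)
    have hCC : C ≤ C + C ^ 2 / (r₀ - δ) := le_add_of_nonneg_right (by positivity)
    have hgr : ∀ r ∈ Ioo (r₀ - δ) (r₀ + 3 * δ),
        ‖gradient φ (X₀ + r • θ)‖ ^ 2 ≤ (C + C ^ 2 / (r₀ - δ)) * r := by
      intro r hr
      have hm := (hray r (Ioo_subset_Icc_self hr)).1
      calc ‖gradient φ (X₀ + r • θ)‖ ^ 2 ≤ C ^ 2 := by gcongr; exact hg _ hm
        _ = C ^ 2 / (r₀ - δ) * (r₀ - δ) := by field_simp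
        _ ≤ (C + C ^ 2 / (r₀ - δ)) * r := by
          gcongr
          · exact le_add_of_nonneg_left hC
          · exact hr.1.le
    obtain ⟨D, K, hK, hD, hDK⟩ := exists_radial_derivative h hVo hVU hφ hu hθ hMθ ha.le
      (by linarith) (by linarith) inter_subset_right hray (bounds hCC).1
      (bounds hCC).2 hgr (hL.mono inter_subset_left)
    have hc : (r₀ - δ + (r₀ + 3 * δ)) / 2 = r₀ + δ := by ring
    rw [hc] at hD hDK
    exact isC1HolderAt_of_radial hVo hφ hY hu hK ha.le (by linarith) hD hDK
      (fun h => absurd h ha.ne') (Or.inr (by linarith)) (by linarith)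

/-! ### Optimality: the function |X|^(4/3). -/

lemma second_fderiv_nonneg_of_isLocalMin {E : Type*} [NormedAddCommGroup E] [NormedSpace ℝ E]
    {T : E → ℝ} {Y : E} (hT : ContDiffAt ℝ 2 T Y) (hmin : IsLocalMin T Y) (Z : E) :
    0 ≤ fderiv ℝ (fderiv ℝ T) Y Z Z := by
  have key : ∀ ε > 0, 0 ≤ fderiv ℝ (fderiv ℝ T) Y Z Z + 2 * ε * ‖Z‖ ^ 2 := by
    intro ε hε
    have hev := (tendsto_line Y Z).eventually ((hT.eventually_abs_taylor_two_le hε).and hmin)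
    obtain ⟨t, ⟨h1, h2⟩, ht⟩ := ((hev.filter_mono nhdsWithin_le_nhds).and
      (self_mem_nhdsWithin (s := Ioi (0 : ℝ)))).exists
    have ht : 0 < t := ht
    rw [hmin.fderiv_eq_zero] at h1
    simp only [add_sub_cancel_left, zero_apply, map_smul, smul_apply, smul_eq_mul, norm_smul] at h1
    have h3 := (abs_le.1 h1).2
    rw [mul_pow, Real.norm_eq_abs, sq_abs] at h3
    have h4 : 0 ≤ t ^ 2 * (fderiv ℝ (fderiv ℝ T) Y Z Z + 2 * ε * ‖Z‖ ^ 2) := by linarith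
    exact nonneg_of_mul_nonneg_right h4 (by positivity)
  have ht : Tendsto (fun ε : ℝ => fderiv ℝ (fderiv ℝ T) Y Z Z + 2 * ε * ‖Z‖ ^ 2) (𝓝[>] 0)
      (𝓝 (fderiv ℝ (fderiv ℝ T) Y Z Z)) := by
    have : Continuous fun ε : ℝ => fderiv ℝ (fderiv ℝ T) Y Z Z + 2 * ε * ‖Z‖ ^ 2 := by fun_prop
    have := this.tendsto 0
    simp only [mul_zero, zero_mul, add_zero] at this
    exact this.mono_left nhdsWithin_le_nhds
  exact ge_of_tendsto ht (by filter_upwards [self_mem_nhdsWithin] with ε hε using key ε hε)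

/-- The infinity-Laplacian is monotone under touching. -/
lemma infinityLaplacian_le_of_isLocalMin {v η : EuclideanSpace ℝ (Fin d) → ℝ}
    {Y : EuclideanSpace ℝ (Fin d)} (hv : ContDiffAt ℝ 2 v Y) (hη : ContDiffAt ℝ 2 η Y)
    (hmin : IsLocalMin (fun X => v X - η X) Y) :
    infinityLaplacian η Y ≤ infinityLaplacian v Y := by
  have hd {w : EuclideanSpace ℝ (Fin d) → ℝ} (hw : ContDiffAt ℝ 2 w Y) :
      ∀ᶠ X in 𝓝 Y, DifferentiableAt ℝ w X :=
    (hw.eventually (by simp)).mono fun X hX => hX.differentiableAt (by norm_num)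
  have hd2 {w : EuclideanSpace ℝ (Fin d) → ℝ} (hw : ContDiffAt ℝ 2 w Y) :
      DifferentiableAt ℝ (fderiv ℝ w) Y :=
    (hw.fderiv_right (m := 1) (by norm_num)).differentiableAt (by norm_num)
  have h1 : fderiv ℝ (fun X => v X - η X) =ᶠ[𝓝 Y] fun X => fderiv ℝ v X - fderiv ℝ η X := by
    filter_upwards [hd hv, hd hη] with X hX1 hX2 using fderiv_fun_sub hX1 hX2
  have h2 : fderiv ℝ v Y = fderiv ℝ η Y := by
    have := hmin.fderiv_eq_zero
    rw [h1.self_of_nhds] at this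
    exact sub_eq_zero.1 this
  have h3 := second_fderiv_nonneg_of_isLocalMin (hv.sub hη) hmin (gradient v Y)
  rw [h1.fderiv_eq, fderiv_fun_sub (hd2 hv) (hd2 hη)] at h3
  have h4 : gradient η Y = gradient v Y := by rw [gradient, gradient, h2]
  rw [infinityLaplacian, infinityLaplacian, h4]
  simpa using h3

lemma gradient_norm_rpow_four_thirds (X : EuclideanSpace ℝ (Fin d)) :
    HasGradientAt (fun X : EuclideanSpace ℝ (Fin d) => ‖X‖ ^ (4 / 3 : ℝ))
      ((4 / 3 * ‖X‖ ^ (-2 / 3 : ℝ)) • X) X := by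
  rw [hasGradientAt_iff_hasFDerivAt]
  refine (hasFDerivAt_norm_rpow X (p := 4 / 3) (by norm_num)).congr_fderiv ?_
  ext v
  norm_num

/-- Only the second derivative along the gradient is needed, and the gradient is radial, so the
computation takes place on the line through 0 and Y, where the function is a multiple of (1 +
tk)^(4/3). -/
lemma infinityLaplacian_norm_rpow_four_thirds {Y : EuclideanSpace ℝ (Fin d)} (hY : Y ≠ 0) :
    infinityLaplacian (fun X : EuclideanSpace ℝ (Fin d) => ‖X‖ ^ (4 / 3 : ℝ)) Y = 64 / 81 := by
  have hY0 : 0 < ‖Y‖ := norm_pos_iff.2 hY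
  have hsm : ContDiffAt ℝ 2 (fun X : EuclideanSpace ℝ (Fin d) => ‖X‖ ^ (4 / 3 : ℝ)) Y :=
    (contDiffAt_norm ℝ hY).rpow_const_of_ne hY0.ne'
  set k : ℝ := 4 / 3 * ‖Y‖ ^ (-2 / 3 : ℝ) with hk
  have hpos : ∀ᶠ t in 𝓝 (0 : ℝ), 0 < 1 + t * k := by
    have : Continuous fun t : ℝ => 1 + t * k := by fun_prop
    exact (this.tendsto 0).eventually (lt_mem_nhds (by simp))
  have hlin (t : ℝ) : HasDerivAt (fun t : ℝ => 1 + t * k) k t := by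
    simpa using ((hasDerivAt_id t).mul_const k).const_add 1
  have hform : ∀ t : ℝ, 0 < 1 + t * k →
      ‖Y + t • k • Y‖ ^ (4 / 3 : ℝ) = ‖Y‖ ^ (4 / 3 : ℝ) * (1 + t * k) ^ (4 / 3 : ℝ) := by
    intro t ht
    rw [show Y + t • k • Y = (1 + t * k) • Y by module, norm_smul, Real.norm_of_nonneg ht.le,
      Real.mul_rpow ht.le hY0.le, mul_comm]
  have := hsm.fderiv_eq_of_line (Z := k • Y)
    (g := fun t => ‖Y‖ ^ (4 / 3 : ℝ) * (k * (4 / 3) * (1 + t * k) ^ (1 / 3 : ℝ)))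
    (c := ‖Y‖ ^ (4 / 3 : ℝ) * (k * (4 / 3) * (k * (1 / 3)))) (by
      filter_upwards [hpos.eventually_nhds] with t ht
      have e1 := ((hlin t).rpow_const (p := 4 / 3) (Or.inl ht.self_of_nhds.ne')).const_mul
        (‖Y‖ ^ (4 / 3 : ℝ))
      refine (e1.congr_of_eventuallyEq (ht.mono fun s hs => hform s hs)).congr_deriv ?_
      norm_num) (by
      have e1 := (((hlin 0).rpow_const (p := 1 / 3) (Or.inl (by simp))).const_mul
        (k * (4 / 3))).const_mul (‖Y‖ ^ (4 / 3 : ℝ))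
      refine e1.congr_deriv ?_
      simp)
  rw [infinityLaplacian, (gradient_norm_rpow_four_thirds Y).gradient, ← hk, this.2, hk]
  have e : ‖Y‖ ^ (4 / 3 : ℝ) * (‖Y‖ ^ (-2 / 3 : ℝ) * ‖Y‖ ^ (-2 / 3 : ℝ)) = 1 := by
    rw [← Real.rpow_add hY0, ← Real.rpow_add hY0]; norm_num
  linear_combination (64 / 81) * e

lemma not_eventually_le_mul_rpow {B C s t : ℝ} (hB : 0 < B) (hst : s < t) :
    ¬ ∀ᶠ x in 𝓝[>] (0 : ℝ), B * x ^ s ≤ C * x ^ t := by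
  intro h
  have h1 : ∀ᶠ x in 𝓝[>] (0 : ℝ), B ≤ C * x ^ (t - s) := by
    filter_upwards [h, self_mem_nhdsWithin] with x hx hx0
    have hx0 : 0 < x := hx0
    rw [Real.rpow_sub hx0, ← mul_div_assoc, le_div_iff₀ (by positivity)]
    exact hx
  have h2 : Tendsto (fun x : ℝ => C * x ^ (t - s)) (𝓝[>] 0) (𝓝 0) := by
    have := ((Real.continuousAt_rpow_const 0 (t - s) (Or.inr (sub_pos.2 hst).le)).tendsto.const_mul
      C).mono_left (nhdsWithin_le_nhds (s := Ioi 0))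
    rwa [Real.zero_rpow (sub_pos.2 hst).ne', mul_zero] at this
  exact absurd (ge_of_tendsto h2 h1) (not_le.2 hB)

/-- Away from 0 the equation holds classically. At 0 a test function has zero gradient: from below
its infinity-Laplacian is 0 ≤ 64/81, and from above none exists, since it would grow at most
quadratically yet dominate |X|^(4/3). -/
lemma isViscositySolution_norm_rpow_four_thirds (hd : 1 ≤ d)
    (U : Set (EuclideanSpace ℝ (Fin d))) :
    IsViscositySolution (fun X : EuclideanSpace ℝ (Fin d) => ‖X‖ ^ (4 / 3 : ℝ))
      (fun _ => 64 / 81) U := by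
  have hsm {Y : EuclideanSpace ℝ (Fin d)} (hY : Y ≠ 0) :
      ContDiffAt ℝ 2 (fun X : EuclideanSpace ℝ (Fin d) => ‖X‖ ^ (4 / 3 : ℝ)) Y :=
    (contDiffAt_norm ℝ hY).rpow_const_of_ne (norm_ne_zero_iff.2 hY)
  have hη2 {η : EuclideanSpace ℝ (Fin d) → ℝ} (hη : ContDiff ℝ ∞ η)
      (Y : EuclideanSpace ℝ (Fin d)) : ContDiffAt ℝ 2 η Y :=
    hη.contDiffAt.of_le (WithTop.coe_le_coe.2 le_top)
  have hgrad0 {η : EuclideanSpace ℝ (Fin d) → ℝ} (hη : ContDiff ℝ ∞ η)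
      (hfd : fderiv ℝ (fun X => ‖X‖ ^ (4 / 3 : ℝ) - η X) 0 = 0) : fderiv ℝ η 0 = 0 := by
    have h0 := gradient_norm_rpow_four_thirds (0 : EuclideanSpace ℝ (Fin d))
    rw [smul_zero, hasGradientAt_iff_hasFDerivAt, map_zero] at h0
    rw [fderiv_fun_sub h0.differentiableAt ((hη2 hη 0).differentiableAt (by norm_num)),
      h0.fderiv, zero_sub, neg_eq_zero] at hfd
    exact hfd
  refine ⟨(continuous_norm.rpow_const fun _ => Or.inr (by norm_num)).continuousOn,
    fun Y _ η hη hmin => ?_, fun Y _ η hη hmax => ?_⟩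
  · rcases eq_or_ne Y 0 with rfl | hY
    · rw [infinityLaplacian, gradient, hgrad0 hη hmin.fderiv_eq_zero]
      norm_num
    · rw [← infinityLaplacian_norm_rpow_four_thirds hY]
      exact infinityLaplacian_le_of_isLocalMin (hsm hY) (hη2 hη Y) hmin
  · rcases eq_or_ne Y 0 with rfl | hY
    · exfalso
      have hfd := hgrad0 hη hmax.fderiv_eq_zero
      have h1 := ((hη2 hη 0).eventually_abs_taylor_two_le one_pos).and hmax
      set B := fderiv ℝ (fderiv ℝ η) 0
      set θ := EuclideanSpace.single (⟨0, hd⟩ : Fin d) (1 : ℝ) with hθ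
      have hθ1 : ‖θ‖ = 1 := by simp [hθ]
      refine not_eventually_le_mul_rpow (B := 1) (C := 1 / 2 * B θ θ + 1) one_pos
        (by norm_num : (4 / 3 : ℝ) < 2) ?_
      filter_upwards [nhdsWithin_le_nhds ((tendsto_line 0 θ).eventually h1), self_mem_nhdsWithin]
        with t ⟨ht1, ht2⟩ ht
      have ht : 0 < t := ht
      rw [hfd] at ht1
      simp only [zero_add, sub_zero, zero_apply, map_smul, smul_apply, smul_eq_mul, norm_smul,
        hθ1, mul_one, Real.norm_of_nonneg ht.le, norm_zero] at ht1 ht2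
      rw [Real.zero_rpow (by norm_num)] at ht2
      have := (abs_le.1 ht1).2
      rw [Real.rpow_ofNat]
      nlinarith
    · rw [← infinityLaplacian_norm_rpow_four_thirds hY]
      refine infinityLaplacian_le_of_isLocalMin (hη2 hη Y) (hsm hY) ?_
      exact hmax.neg.congr (Eventually.of_forall fun X => by simp)

lemma not_isC1HolderLoc_norm_rpow_four_thirds (hd : 1 ≤ d) {α : ℝ≥0} (hα : 1 / 3 < α) :
    ¬ IsC1HolderLoc α (fun X : EuclideanSpace ℝ (Fin d) => ‖X‖ ^ (4 / 3 : ℝ))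
      (Metric.ball 0 1) := by
  rintro ⟨-, h⟩
  obtain ⟨C, hC⟩ := h (Metric.closedBall 0 (1 / 2))
    (Metric.closedBall_subset_ball (by norm_num)) (isCompact_closedBall _ _)
  set θ := EuclideanSpace.single (⟨0, hd⟩ : Fin d) (1 : ℝ) with hθ
  have hθ1 : ‖θ‖ = 1 := by simp [hθ]
  have hα' : (1 / 3 : ℝ) < α := by
    have := NNReal.coe_lt_coe.2 hα
    simpa using this
  refine not_eventually_le_mul_rpow (B := 4 / 3) (C := C) (by norm_num) hα' ?_
  filter_upwards [Ioo_mem_nhdsGT (by norm_num : (0 : ℝ) < 1 / 2)] with t ht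
  have ht0 : 0 < t := ht.1
  have hn : ‖t • θ‖ = t := by rw [norm_smul, hθ1, mul_one, Real.norm_of_nonneg ht0.le]
  have := hC.dist_le (x := t • θ) (y := 0) (by
    rw [mem_closedBall_zero_iff, hn]; exact ht.2.le) (by simp)
  rw [(gradient_norm_rpow_four_thirds _).gradient, (gradient_norm_rpow_four_thirds _).gradient,
    smul_zero, dist_zero_right, dist_zero_right, norm_smul, hn,
    Real.norm_of_nonneg (by positivity)] at this
  refine le_trans (le_of_eq ?_) this
  rw [mul_assoc, ← Real.rpow_add_one ht0.ne']
  norm_num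

end Viscosity

/-! ### The main theorem. -/

theorem theorem4p3 (d : ℕ) (hd : 1 ≤ d) :
    (∀ (u f : EuclideanSpace ℝ (Fin d) → ℝ),
      MeasureTheory.MemLp f ⊤ (MeasureTheory.volume.restrict (Metric.ball 0 1)) →
      IsViscositySolution u f (Metric.ball 0 1) →
      ∀ (X₀ : EuclideanSpace ℝ (Fin d)) (V : Set (EuclideanSpace ℝ (Fin d))),
        IsOpen V → X₀ ∈ V → V ⊆ Metric.ball 0 1 →
        SmoothUpToRadialSingularityOn u X₀ V →
        IsC1HolderLoc (1 / 3) u V ∧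
        ((∀ X ∈ Metric.ball 0 1 \ V, ContDiffAt ℝ 2 u X) →
          IsC1HolderLoc (1 / 3) u (Metric.ball 0 1))) ∧
    (∃ (u f : EuclideanSpace ℝ (Fin d) → ℝ) (X₀ : EuclideanSpace ℝ (Fin d)),
      MeasureTheory.MemLp f ⊤ (MeasureTheory.volume.restrict (Metric.ball 0 1)) ∧
      IsViscositySolution u f (Metric.ball 0 1) ∧
      X₀ ∈ Metric.ball 0 1 ∧
      SmoothUpToRadialSingularityOn u X₀ (Metric.ball 0 1) ∧
      ∀ α : ℝ≥0, 1 / 3 < α → ¬ IsC1HolderLoc α u (Metric.ball 0 1)) := by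
  refine ⟨fun u f hf h X₀ V hVo hX₀ hVU hrad => ?_, fun X => ‖X‖ ^ (4 / 3 : ℝ), fun _ => 64 / 81, 0,
    ?_, isViscositySolution_norm_rpow_four_thirds hd _, by simp,
    ⟨fun _ => 0, fun r => r ^ (4 / 3 : ℝ), contDiffOn_const, Asymptotics.isBigO_zero _ _, by simp⟩,
    fun α hα => not_isC1HolderLoc_norm_rpow_four_thirds hd hα⟩
  · obtain ⟨M, hM⟩ := hf.exists_ae_abs_le measurableSet_ball
    have hV : ∀ Y ∈ V, IsC1HolderAt (1 / 3) u Y := fun Y hY =>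
      h.isC1HolderAt hd hM hVo hX₀ hVU hrad hY
    have hpos : (0 : ℝ≥0) < 1 / 3 := by positivity
    have hle : (1 / 3 : ℝ≥0) ≤ 1 := by norm_num [← NNReal.coe_le_coe]
    refine ⟨isC1HolderLoc_of_forall hpos hV, fun h2 => isC1HolderLoc_of_forall hpos fun Y hY => ?_⟩
    by_cases hYV : Y ∈ V
    · exact hV Y hYV
    · exact (h2 Y ⟨hY, hYV⟩).isC1HolderAt hle
  · have : IsFiniteMeasure (MeasureTheory.volume.restrict
        (Metric.ball (0 : EuclideanSpace ℝ (Fin d)) 1)) :=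
      ⟨by rw [Measure.restrict_apply_univ]; exact measure_ball_lt_top⟩
    exact memLp_const _
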